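/- **Setting.** Let $n,k,m$ be positive integers with $n\ge k$, let $J=\{1,\dots,n\}$, and let $M\subset\mathbb C^n$ be open, with coordinates $z_i$ and coordinate vector fields $\partial_i=\partial/\partial z_i$. A *Frobenius like structure of order $(n,k,m)$* on $M$ is a tuple $(M,K,\nabla^K,C,S,\zeta,(J,\mathcal F))$ where * $K\to M$ is a holomorphic vector bundle of finite rank with a flat holomorphic connection $\nabla^K$; * $C:\mathcal O(K)\to\Omega^1_M\otimes\mathcal O(K)$ is an $\mathcal O_M$-linear map with $C_XC_Y=C_YC_X$ for all vector fields $X,Y$, and with $\nabla^K_{\partial_i}(C_{\partial_j})=\nabla^K_{\partial_j}(C_{\partial_i})$ for all $i,j\in J$; * $S:\mathcal O(K)^m\to\mathcal O_M$ is an $\mathcal O_M$-multilinear form that is $\nabla^K$-flat and Higgs field invariant, i.e. $S(C_Xs_1,s_2,\dots,s_m)=S(s_1,C_Xs_2,\dots,s_m)=\dots=S(s_1,s_2,\dots,C_Xs_m)$; * $\zeta$ is a global nowhere vanishing holomorphic section of $K$; * $(J,\mathcal F)$ is a matroid of rank $k$ on $J$, and for each base (maximal independent set) $I=\{i_1,\dots,i_k\}$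 the section $C_I\zeta:=C_{\partial_{i_1}}\cdots C_{\partial_{i_k}}\zeta$ is $\nabla^K$-flat. For $I=\{i_1,\dots,i_k\}\subset J$ put $\partial_I=\partial_{i_1}\cdots\partial_{i_k}$. A holomorphic function $Q$ on an open $U\subset M$ is a *potential of the first kind* on $U$ if $\partial_{I_1}\cdots\partial_{I_m}Q=S(C_{I_1}\zeta,\dots,C_{I_m}\zeta)$ on $U$ for all bases $I_1,\dots,I_m$. A holomorphic function $L$ on $U$ is a *potential of the second kind* on $U$ if $\partial_i\partial_{I_1}\cdots\partial_{I_m}L=S(C_{\partial_i}C_{I_1}\zeta,C_{I_2}\zeta,\dots,C_{I_m}\zeta)$ on $U$ for all bases $I_1,\dots,I_m$ and all $i\in J$. For a multi-index $T\in\mathbb Z_{\ge0}^J$ write $|T|=\sum_iT(i)$, $T!=\prod_iT(i)!$, $\partial_T=\prod_i\partial_i^{T(i)}$, $C_T=\prod_iC_{\partial_i}^{T(i)}$, $(z-x)^T=\prod_i(z_i-x_i)^{T(i)}$. Call $T$ a *strong $(mk+l)$-system* if it is the sum of the indicator functions of $m$ bases and of a multi-index $R$ with $|R|=l$. **Theorem.**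 For every Frobenius like structure of order $(n,k,m)$ and every $x\in M$ there is an open neighbourhood $U\subset M$ of $x$ on which a potential $Q$ of the first kind and a potential $L$ of the second kind exist. Moreover $Q$ and $L$ can be chosen as follows. 1. $Q$ is the polynomial $$Q(z)=\sum_{T}\frac1{T!}\,S(C_T\zeta,\zeta,\dots,\zeta)(x)\,z^T,$$ where $T$ runs through the strong $mk$-systems. 2. $L$ is the sum on $U$ of a convergent power series $L(z)=\sum_Ta_T(z-x)^T$ with $$a_T=\frac1{T!}\bigl(\partial_{T_1}S(C_{T_2}\zeta,\zeta,\dots,\zeta)\bigr)(x)$$ for every decomposition $T=T_1+T_2$ with $T_2$ a strong $(mk+1)$-system and $T_1\in\mathbb Z_{\ge0}^J$ (in particular the right-hand side does not depend on the decomposition), and $a_T=0$ if $T$ has no such decomposition. -/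

import Mathlib

open Bundle TopologicalSpace
open scoped Manifold ContDiff

noncomputable section

/-! ### Partial derivatives on `ℂⁿ` -/

/-- The partial derivative `∂_i f` of a function on `ℂⁿ`; its value at a point only depends on the
germ of `f` at that point. -/
def partialDeriv {n : ℕ} (i : Fin n) (f : (Fin n → ℂ) → ℂ) : (Fin n → ℂ) → ℂ :=
  fun z => fderiv ℂ f z (Pi.single i 1)

/-- `∂_{i₁} ⋯ ∂_{i_r} f` for a word `[i₁, …, i_r]`. -/
def partialWord {n : ℕ} (w : List (Fin n)) (f : (Fin n → ℂ) → ℂ) : (Fin n → ℂ) → ℂ :=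
  w.foldr partialDeriv f

/-- `∂_I f` for a finite set `I` of indices. The elements are taken in increasing order; for
holomorphic functions the order is irrelevant. -/
def partialSet {n : ℕ} (I : Finset (Fin n)) (f : (Fin n → ℂ) → ℂ) : (Fin n → ℂ) → ℂ :=
  partialWord (I.sort (· ≤ ·)) f

/-- `∂_{I₁} ⋯ ∂_{I_m} f` for a tuple of finite sets of indices. -/
def partialSets {n m : ℕ} (I : Fin m → Finset (Fin n)) (f : (Fin n → ℂ) → ℂ) :
    (Fin n → ℂ) → ℂ :=
  (List.ofFn I).foldr partialSet f

/-- The increasing word in which every `i` occurs `T i` times. -/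
def multiWord {n : ℕ} (T : Fin n →₀ ℕ) : List (Fin n) :=
  (Finsupp.toMultiset T).sort (· ≤ ·)

/-- `∂_T f` for a multi-index `T`. -/
def partialMulti {n : ℕ} (T : Fin n →₀ ℕ) (f : (Fin n → ℂ) → ℂ) : (Fin n → ℂ) → ℂ :=
  partialWord (multiWord T) f

/-- `T! = ∏ T(i)!`. -/
def multiFactorial {n : ℕ} (T : Fin n →₀ ℕ) : ℕ :=
  ∏ i, (T i).factorial

/-- `(z - x)^T = ∏ (z_i - x_i)^{T(i)}`. -/
def multiPow {n : ℕ} (z x : Fin n → ℂ) (T : Fin n →₀ ℕ) : ℂ :=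
  ∏ i, (z i - x i) ^ T i

/-! ### Strong systems -/

/-- The multi-index of a finite set. -/
def setIndex {n : ℕ} (I : Finset (Fin n)) : Fin n →₀ ℕ :=
  ∑ i ∈ I, Finsupp.single i 1

/-- `T` is the sum of (the multi-indices of) `m` bases of the matroid and of an arbitrary
multi-index of degree `l`. -/
def IsStrongSystem {n : ℕ} (N : Matroid (Fin n)) (m l : ℕ) (T : Fin n →₀ ℕ) : Prop :=
  ∃ (I : Fin m → Finset (Fin n)) (R : Fin n →₀ ℕ), (∀ j, N.IsBase (I j : Set (Fin n))) ∧
    R.degree = l ∧ T = ∑ j, setIndex (I j) + R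

/-! ### Holomorphic bundles with connection over an open subset of `ℂⁿ` -/

/-- The coordinate vector field `∂_i` on an open subset of `ℂⁿ`. -/
def coordField {n : ℕ} {M : Opens (Fin n → ℂ)} (i : Fin n) (x : M) :
    TangentSpace 𝓘(ℂ, Fin n → ℂ) x :=
  (Pi.single i 1 : Fin n → ℂ)

section Bundle

variable {n : ℕ} {M : Opens (Fin n → ℂ)}
  (F : Type*) [NormedAddCommGroup F] [NormedSpace ℂ F]
  {K : M → Type*} [TopologicalSpace (TotalSpace F K)]
  [∀ x, AddCommGroup (K x)] [∀ x, Module ℂ (K x)] [∀ x, TopologicalSpace (K x)]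
  [∀ x, IsTopologicalAddGroup (K x)] [∀ x, ContinuousSMul ℂ (K x)]
  [FiberBundle F K] [VectorBundle ℂ F K]

/-- The section `σ` of `K` is holomorphic on `U`. -/
def IsHolSectionOn (σ : Π x : M, K x) (U : Set M) : Prop :=
  ContMDiffOn 𝓘(ℂ, Fin n → ℂ) (𝓘(ℂ, Fin n → ℂ).prod 𝓘(ℂ, F)) ω
    (fun x => TotalSpace.mk' F x (σ x)) U

variable {F}

/-- `∇_{∂_i} σ`. -/
def covCoord (D : CovariantDerivative 𝓘(ℂ, Fin n → ℂ) F K) (i : Fin n) (σ : Π x : M, K x) :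
    Π x : M, K x :=
  fun x => D σ x (coordField i x)

/-- `C_{i₁} ⋯ C_{i_r} : K_x → K_x` for a word `[i₁, …, i_r]`, where `C_i = C_{∂_i}`. -/
def higgsWord (C : Π x : M, TangentSpace 𝓘(ℂ, Fin n → ℂ) x →L[ℂ] K x →L[ℂ] K x)
    (w : List (Fin n)) (x : M) : K x →L[ℂ] K x :=
  (w.map fun i => C x (coordField i x)).prod

/-- `C_I` for a finite set `I` of indices (the order is irrelevant if the `C_{∂_i}` commute). -/
def higgsSet (C : Π x : M, TangentSpace 𝓘(ℂ, Fin n → ℂ) x →L[ℂ] K x →L[ℂ] K x)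
    (I : Finset (Fin n)) (x : M) : K x →L[ℂ] K x :=
  higgsWord C (I.sort (· ≤ ·)) x

/-- `C_T` for a multi-index `T`. -/
def higgsMulti (C : Π x : M, TangentSpace 𝓘(ℂ, Fin n → ℂ) x →L[ℂ] K x →L[ℂ] K x)
    (T : Fin n →₀ ℕ) (x : M) : K x →L[ℂ] K x :=
  higgsWord C (multiWord T) x

end Bundle

/-- A Frobenius like structure of order `(n, k, m)` on the vector bundle `K` over the open set
`M ⊆ ℂⁿ`. Conditions on the sheaf of holomorphic sections are imposed on the holomorphic sections
over all open subsets `U` of `M`; a 1-form is holomorphic iff its values on the coordinate vector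
fields `∂_i` are. -/
structure FrobeniusLikeStructure {n : ℕ} (k m : ℕ) (M : Opens (Fin n → ℂ))
    (F : Type*) [NormedAddCommGroup F] [NormedSpace ℂ F]
    (K : M → Type*) [TopologicalSpace (TotalSpace F K)]
    [∀ x, AddCommGroup (K x)] [∀ x, Module ℂ (K x)] [∀ x, TopologicalSpace (K x)]
    [∀ x, IsTopologicalAddGroup (K x)] [∀ x, ContinuousSMul ℂ (K x)]
    [FiberBundle F K] [VectorBundle ℂ F K] where
  /-- the connection `∇^K` -/
  conn : CovariantDerivative 𝓘(ℂ, Fin n → ℂ) F K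
  /-- the Higgs field -/
  C : Π x : M, TangentSpace 𝓘(ℂ, Fin n → ℂ) x →L[ℂ] K x →L[ℂ] K x
  /-- the `m`-linear form -/
  S : Π x : M, MultilinearMap ℂ (fun _ : Fin m => K x) ℂ
  /-- the distinguished section -/
  ζ : Π x : M, K x
  /-- the matroid -/
  matroid : Matroid (Fin n)
  /-- the connection is holomorphic -/
  conn_hol : ∀ (U : Opens M) (σ : Π x : M, K x), IsHolSectionOn F σ U →
    ∀ i, IsHolSectionOn F (covCoord conn i σ) U
  /-- the connection is flat -/
  conn_flat : ∀ (U : Opens M) (σ : Π x : M, K x), IsHolSectionOn F σ U → ∀ i j, ∀ x ∈ U,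
    covCoord conn i (covCoord conn j σ) x = covCoord conn j (covCoord conn i σ) x
  /-- the Higgs field is holomorphic -/
  C_hol : ∀ (U : Opens M) (σ : Π x : M, K x), IsHolSectionOn F σ U →
    ∀ i, IsHolSectionOn F (fun x => C x (coordField i x) (σ x)) U
  /-- the endomorphisms `C_X` commute -/
  C_comm : ∀ (x : M) (X Y : TangentSpace 𝓘(ℂ, Fin n → ℂ) x), C x X * C x Y = C x Y * C x X
  /-- the integrability condition `∇_{∂_i}(C_{∂_j}) = ∇_{∂_j}(C_{∂_i})` -/
  integrable : ∀ (U : Opens M) (σ : Π x : M, K x), IsHolSectionOn F σ U → ∀ i j, ∀ x ∈ U,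
    covCoord conn i (fun y => C y (coordField j y) (σ y)) x
        - C x (coordField j x) (covCoord conn i σ x) =
      covCoord conn j (fun y => C y (coordField i y) (σ y)) x
        - C x (coordField i x) (covCoord conn j σ x)
  /-- `S` is holomorphic -/
  S_hol : ∀ (U : Opens M) (σ : Fin m → Π x : M, K x), (∀ a, IsHolSectionOn F (σ a) U) →
    ContMDiffOn 𝓘(ℂ, Fin n → ℂ) 𝓘(ℂ) ω (fun x => S x fun a => σ a x) U
  /-- `S` is flat -/
  S_flat : ∀ (U : Opens M) (σ : Fin m → Π x : M, K x), (∀ a, IsHolSectionOn F (σ a) U) →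
    ∀ i, ∀ x ∈ U, mfderiv 𝓘(ℂ, Fin n → ℂ) 𝓘(ℂ) (fun y => S y fun a => σ a y) x (coordField i x) =
      ∑ a, S x (Function.update (fun b => σ b x) a (covCoord conn i (σ a) x))
  /-- `S` is Higgs field invariant -/
  S_higgs : ∀ (x : M) (X : TangentSpace 𝓘(ℂ, Fin n → ℂ) x) (s : Fin m → K x) (a b : Fin m),
    S x (Function.update s a (C x X (s a))) = S x (Function.update s b (C x X (s b)))
  /-- `ζ` is holomorphic -/
  ζ_hol : IsHolSectionOn F ζ Set.univ
  /-- `ζ` vanishes nowhere -/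
  ζ_ne_zero : ∀ x, ζ x ≠ 0
  /-- the ground set of the matroid is `J = {1, …, n}` -/
  matroid_ground : matroid.E = Set.univ
  /-- the matroid has rank `k` -/
  matroid_rank : matroid.eRank = k
  /-- `C_I ζ` is flat for every base `I` of the matroid -/
  flat_base : ∀ I : Finset (Fin n), matroid.IsBase (I : Set (Fin n)) →
    ∀ x, conn (fun y => higgsSet C I y (ζ y)) x = 0

namespace FrobeniusLikeStructure

variable {n k m : ℕ} {M : Opens (Fin n → ℂ)}
  {F : Type*} [NormedAddCommGroup F] [NormedSpace ℂ F]
  {K : M → Type*} [TopologicalSpace (TotalSpace F K)]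
  [∀ x, AddCommGroup (K x)] [∀ x, Module ℂ (K x)] [∀ x, TopologicalSpace (K x)]
  [∀ x, IsTopologicalAddGroup (K x)] [∀ x, ContinuousSMul ℂ (K x)]
  [FiberBundle F K] [VectorBundle ℂ F K]
  (D : FrobeniusLikeStructure k m M F K)

/-- `Q` is a potential of the first kind on the open set `U ⊆ M`. -/
def IsPotentialFirstKind (U : Opens (Fin n → ℂ)) (Q : (Fin n → ℂ) → ℂ) : Prop :=
  AnalyticOnNhd ℂ Q U ∧
    ∀ I : Fin m → Finset (Fin n), (∀ j, D.matroid.IsBase (I j : Set (Fin n))) →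
      ∀ z : M, (z : Fin n → ℂ) ∈ U →
        partialSets I Q z = D.S z fun j => higgsSet D.C (I j) z (D.ζ z)

/-- `L` is a potential of the second kind on the open set `U ⊆ M`. -/
def IsPotentialSecondKind [NeZero m] (U : Opens (Fin n → ℂ)) (L : (Fin n → ℂ) → ℂ) : Prop :=
  AnalyticOnNhd ℂ L U ∧
    ∀ I : Fin m → Finset (Fin n), (∀ j, D.matroid.IsBase (I j : Set (Fin n))) →
      ∀ i : Fin n, ∀ z : M, (z : Fin n → ℂ) ∈ U →
        partialDeriv i (partialSets I L) z =
          D.S z (Function.update (fun j => higgsSet D.C (I j) z (D.ζ z)) 0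
            (D.C z (coordField i z) (higgsSet D.C (I 0) z (D.ζ z))))

/-- The function `S(C_T ζ, ζ, …, ζ)` on `M`. -/
def matrixElement [NeZero m] (T : Fin n →₀ ℕ) (z : M) : ℂ :=
  D.S z (Function.update (fun _ => D.ζ z) 0 (higgsMulti D.C T z (D.ζ z)))

open Classical in
/-- The polynomial `∑_T (1 / T!) S(C_T ζ, ζ, …, ζ)(x) z^T`, where `T` runs through all sums of `m`
bases. -/
def firstKindPolynomial [NeZero m] (x : M) : MvPolynomial (Fin n) ℂ :=
  ∑ T ∈ (Finset.univ.finsuppAntidiag (m * k)).filter (IsStrongSystem D.matroid m 0),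
    MvPolynomial.monomial T ((multiFactorial T : ℂ)⁻¹ * D.matrixElement T x)

/-- The number `(1 / (T₁ + T₂)!) (∂_{T₁} S(C_{T₂} ζ, ζ, …, ζ))(x)`. To differentiate it, the
function on `M` is extended by zero to `ℂⁿ`. -/
def secondKindCoeff [NeZero m] (x : M) (T₁ T₂ : Fin n →₀ ℕ) : ℂ :=
  (multiFactorial (T₁ + T₂) : ℂ)⁻¹ *
    partialMulti T₁ (Function.extend Subtype.val (D.matrixElement T₂) 0) x

end FrobeniusLikeStructure

end

/-! Write g_T = S(C_T ζ, ζ, …, ζ). Higgs invariance lets all fields be collected in one slot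
(`S_higgsMulti`), so for bases I_1, …, I_m with sum B the function S(C_{I_1} ζ, …, C_{I_m} ζ) is
g_B: only the sum matters. Since S and all C_I ζ are flat, g_B is locally constant
(`matrixElement_tupleIndex_eq`). All monomials of Q have degree mk, so ∂_B picks out exactly the
coefficient of z^B, which settles Q.

For L, the equations ∂_T L = g_T have to be solved simultaneously for all strong (mk+1)-systems T. A
power series with prescribed coefficients does it (`exists_common_antiderivative`), provided that
∂_S g_T(x) depends only on S + T; it converges because finitely many convergent series dominate it.
Integrability and flatness give the elementary case ∂_i g_{B+e_j} = ∂_j g_{B+e_i}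
(`partialDeriv_matrixElement_comm`). The general case (`multiFactorial_mul_coeff_eq`) reduces to it
by a matroid statement (`ExchangeStable.of_base_tuple`): two sums of m bases below a multi-index T
are linked by steps B' = B + e_v - e_u with B + e_v ≤ T.

For that, draw an edge u → v when some base of the tuple can trade u for v. From an i that B
contains more often than B', some j that B contains less often is reachable; otherwise counting
elements inside the reachable set gives a contradiction. Along a shortest path the trades can be
made from the last to the first, since without shortcuts a trade does not disturb the earlier edges.
The net effect is B - e_i + e_j, which is closer to B'. -/

noncomputable section

/-! ### Exchange properties of sums of bases -/

section Exchange

variable {n m : ℕ}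

theorem setIndex_apply (I : Finset (Fin n)) (i : Fin n) :
    setIndex I i = if i ∈ I then 1 else 0 := by
  classical
  simp [setIndex, Finsupp.finsetSum_apply, Finsupp.single_apply]

/-- Exchanging `u` for `v` in `I`. -/
theorem setIndex_insert_erase {I : Finset (Fin n)} {u v : Fin n} (hu : u ∈ I) (hv : v ∉ I) :
    setIndex (insert v (I.erase u)) + Finsupp.single u 1 = setIndex I + Finsupp.single v 1 := by
  classical
  have h1 : v ∉ I.erase u := fun h => hv (Finset.mem_of_mem_erase h)
  unfold setIndex
  rw [Finset.sum_insert h1, ← Finset.sum_erase_add I _ hu]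
  abel

/-- The sum of the multi-indices of a tuple of sets. -/
def tupleIndex (I : Fin m → Finset (Fin n)) : Fin n →₀ ℕ :=
  ∑ j, setIndex (I j)

theorem tupleIndex_update {I : Fin m → Finset (Fin n)} {a : Fin m} {u v : Fin n}
    (hu : u ∈ I a) (hv : v ∉ I a) :
    tupleIndex (Function.update I a (insert v ((I a).erase u))) + Finsupp.single u 1 =
      tupleIndex I + Finsupp.single v 1 := by
  classical
  unfold tupleIndex
  rw [← Finset.add_sum_erase _ _ (Finset.mem_univ a),
    ← Finset.add_sum_erase _ (fun j => setIndex (I j)) (Finset.mem_univ a)]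
  have : ∑ j ∈ Finset.univ.erase a,
      setIndex (Function.update I a (insert v ((I a).erase u)) j) =
      ∑ j ∈ Finset.univ.erase a, setIndex (I j) := by
    refine Finset.sum_congr rfl fun j hj => ?_
    rw [Function.update_of_ne (Finset.ne_of_mem_erase hj)]
  rw [this, Function.update_self, add_right_comm, setIndex_insert_erase hu hv, add_right_comm]

variable (N : Matroid (Fin n))

/-- Some set `I a` of the tuple contains `u` and remains independent after exchanging `u`
for `v`. -/
def ExchangeEdge (I : Fin m → Finset (Fin n)) (u v : Fin n) : Prop :=
  ∃ a, u ∈ I a ∧ v ∉ N.closure ((I a : Set (Fin n)) \ {u})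

variable {N}

/-- Over Y = I \ {s, u}, the element v lies in the closure of Y + u but not in that of Y, so by the
exchange property u and v span the same flat over Y. Hence trading u for v leaves the edges out of s
unchanged. -/
theorem closure_exchange_sdiff (hE : N.E = Set.univ) {I : Set (Fin n)} {u v s : Fin n}
    (hu : u ∈ I) (hv : v ∉ N.closure (I \ {u})) (hs : s ∈ I) (hsu : s ≠ u)
    (hvs : v ∈ N.closure (I \ {s})) :
    N.closure (insert v (I \ {u}) \ {s}) = N.closure (I \ {s}) := by
  have hsub : ∀ X, X ⊆ N.closure X := fun X => N.subset_closure X (by simp [hE])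
  have hvne : v ≠ s := by
    rintro rfl
    exact hv (hsub _ ⟨hs, hsu⟩)
  have h1 : insert v (I \ {u}) \ {s} = insert v ((I \ {s}) \ {u}) := by
    ext y; simp only [Set.mem_sdiff, Set.mem_insert_iff, Set.mem_singleton_iff]
    by_cases hy : y = v
    · subst hy; simp [hvne]
    · simp [hy]; tauto
  have h2 : I \ {s} = insert u ((I \ {s}) \ {u}) := by
    rw [Set.insert_sdiff_singleton, Set.insert_eq_of_mem]
    exact ⟨hu, hsu.symm⟩
  rw [h1]
  nth_rewrite 2 [h2]
  refine Matroid.closure_insert_congr ⟨h2 ▸ hvs, fun h => hv ?_⟩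
  exact N.closure_subset_closure (by intro y hy; exact ⟨hy.1.1, hy.2⟩) h

/-- If no exchange leads from `X` out of `X`, then every base has at least as many elements
in `X` as the base `I`. -/
theorem encard_diff_le_of_closed (hE : N.E = Set.univ) {I I' X : Set (Fin n)}
    (hI : N.IsBase I) (hI' : N.IsBase I')
    (hX : ∀ u ∈ I, u ∈ X → ∀ v ∉ X, v ∈ N.closure (I \ {u})) :
    (I' \ X).encard ≤ (I \ X).encard := by
  have key : I' \ X ⊆ N.closure (I \ X) := by
    rintro v ⟨-, hv⟩
    have hvE : v ∈ N.E := by simp [hE]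
    -- `I \ X` is the intersection of the `I \ {u}` over `u ∈ I ∩ X`, and closure commutes with
    -- nonempty intersections inside an independent set. For the empty family, `I \ X` is the whole
    -- base.
    rcases (I ∩ X).eq_empty_or_nonempty with h0 | ⟨u₀, hu₀⟩
    · have : I \ X = I := by
        rw [sdiff_eq_left, Set.disjoint_iff_inter_eq_empty, h0]
      rw [this, hI.closure_eq]; exact hvE
    · have : Nonempty (I ∩ X : Set (Fin n)) := ⟨⟨u₀, hu₀⟩⟩
      have h1 : I \ X = ⋂ u : (I ∩ X : Set (Fin n)), I \ {(u : Fin n)} := by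
        ext y
        simp only [Set.mem_sdiff, Set.mem_iInter, Set.mem_singleton_iff, Subtype.forall,
          Set.mem_inter_iff]
        constructor
        · rintro ⟨h, h'⟩ a ⟨_, ha⟩
          exact ⟨h, fun e => h' (e ▸ ha)⟩
        · intro h
          have hy := (h u₀ hu₀).1
          exact ⟨hy, fun hyX => (h y ⟨hy, hyX⟩).2 rfl⟩
      rw [h1, hI.indep.closure_iInter_eq_biInter_closure_of_forall_subset
        (fun _ => Set.sdiff_subset)]
      exact Set.mem_iInter.2 fun u => hX u u.2.1 u.2.2 v hv
  calc (I' \ X).encard ≤ N.eRk (N.closure (I \ X)) :=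
        (hI'.indep.subset Set.sdiff_subset).encard_le_eRk_of_subset key
    _ = (I \ X).encard := by
        rw [N.eRk_closure_eq, (hI.indep.subset Set.sdiff_subset).eRk_eq_encard]

/-- Bases are equicardinal, so the bound outside `X` turns into the reverse bound inside `X`. -/
theorem card_inter_le_of_closed (hE : N.E = Set.univ) {I I' X : Finset (Fin n)}
    (hI : N.IsBase (I : Set (Fin n))) (hI' : N.IsBase (I' : Set (Fin n)))
    (hX : ∀ u ∈ I, u ∈ X → ∀ v ∉ X, v ∈ N.closure ((I : Set (Fin n)) \ {u})) :
    (I ∩ X).card ≤ (I' ∩ X).card := by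
  classical
  have h := encard_diff_le_of_closed (X := (X : Set (Fin n))) hE hI hI'
    (fun u hu huX v hv => hX u (by simpa using hu) (by simpa using huX) v (by simpa using hv))
  rw [← Finset.coe_sdiff, ← Finset.coe_sdiff, Set.encard_coe_eq_coe_finsetCard,
    Set.encard_coe_eq_coe_finsetCard, Nat.cast_le] at h
  have h2 : I.card = I'.card := by
    have := hI.encard_eq_encard_of_isBase hI'
    simpa [Set.encard_coe_eq_coe_finsetCard] using this
  have h3 := Finset.card_sdiff_add_card_inter I X
  have h4 := Finset.card_sdiff_add_card_inter I' X
  omega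

theorem sum_tupleIndex (I : Fin m → Finset (Fin n)) (X : Finset (Fin n)) :
    ∑ i ∈ X, tupleIndex I i = ∑ j, (I j ∩ X).card := by
  classical
  simp only [tupleIndex, Finsupp.finsetSum_apply, setIndex_apply]
  rw [Finset.sum_comm]
  refine Finset.sum_congr rfl fun j _ => ?_
  rw [Finset.sum_ite_mem, Finset.inter_comm]
  simp

/-- If `i` occurs more often in the first sum of bases than in the second one, then a chain of
exchanges leads from `i` to an element which occurs less often. -/
theorem exists_reachable_deficient (hE : N.E = Set.univ) {I I' : Fin m → Finset (Fin n)}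
    (hI : ∀ j, N.IsBase (I j : Set (Fin n))) (hI' : ∀ j, N.IsBase (I' j : Set (Fin n)))
    {i : Fin n} (hi : tupleIndex I' i < tupleIndex I i) :
    ∃ j, Relation.ReflTransGen (ExchangeEdge N I) i j ∧ tupleIndex I j < tupleIndex I' j := by
  classical
  by_contra! hcon
  -- No edge leaves the reachable set, so each `I j` has at most as many elements in it as `I' j`;
  -- summing over `j` contradicts the strict excess at `i`.
  let X : Finset (Fin n) := Finset.univ.filter (Relation.ReflTransGen (ExchangeEdge N I) i)
  have hmem : ∀ v, v ∈ X ↔ Relation.ReflTransGen (ExchangeEdge N I) i v := by simp [X]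
  have h1 : ∑ v ∈ X, tupleIndex I' v < ∑ v ∈ X, tupleIndex I v :=
    Finset.sum_lt_sum (fun v hv => hcon v ((hmem v).1 hv)) ⟨i, (hmem i).2 .refl, hi⟩
  rw [sum_tupleIndex, sum_tupleIndex] at h1
  refine absurd h1 (not_lt.2 (Finset.sum_le_sum fun j _ => ?_))
  refine card_inter_le_of_closed hE (hI j) (hI' j) fun u hu huX v hv => ?_
  by_contra hcl
  exact hv ((hmem v).2 (((hmem u).1 huX).tail ⟨j, hu, hcl⟩))

/-- A chain of minimal length has no shortcuts. -/
theorem exists_chain_without_shortcut {α : Type*} {r : α → α → Prop} {a b : α}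
    (h : Relation.ReflTransGen r a b) :
    ∃ (l : ℕ) (u : ℕ → α), u 0 = a ∧ u l = b ∧ (∀ s < l, r (u s) (u (s + 1))) ∧
      ∀ s t, s + 1 < t → t ≤ l → ¬ r (u s) (u t) := by
  classical
  let P : ℕ → Prop := fun l => ∃ u : ℕ → α, u 0 = a ∧ u l = b ∧ ∀ s < l, r (u s) (u (s + 1))
  have hP : ∃ l, P l := by
    induction h with
    | refl => exact ⟨0, fun _ => a, rfl, rfl, by simp⟩
    | @tail b c _ hbc ih =>
      obtain ⟨l, u, h0, hl, hu⟩ := ih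
      refine ⟨l + 1, fun s => if s ≤ l then u s else c, by simp [h0], by simp, fun s hs => ?_⟩
      rcases Nat.lt_succ_iff_lt_or_eq.1 hs with h | rfl
      · have h' : s + 1 ≤ l := h
        simp only [h.le, h', if_true]
        exact hu s h
      · simpa [hl] using hbc
  obtain ⟨u, h0, hl, hu⟩ := Nat.find_spec hP
  refine ⟨Nat.find hP, u, h0, hl, hu, fun s t hst ht hr => ?_⟩
  set l := Nat.find hP
  -- Jumping from `s` to `t` skips `t - s - 1 > 0` vertices and yields a shorter chain.
  refine Nat.find_min hP (m := l - (t - s - 1)) (by omega)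
    ⟨fun p => if p ≤ s then u p else u (p + (t - s - 1)), by simp [h0], ?_, fun p hp => ?_⟩
  · have h1 : ¬ l - (t - s - 1) ≤ s := by omega
    simp only [h1, if_false]
    rw [← hl]; congr 1; omega
  · rcases lt_trichotomy p s with h | h | h
    · have h' : p + 1 ≤ s := h
      simp only [h.le, h', if_true]
      exact hu p (by omega)
    · subst h
      simp only [le_refl, if_true, Nat.not_succ_le_self, if_false]
      convert hr using 2
      omega
    · have h1 : ¬ p ≤ s := by omega
      have h2 : ¬ p + 1 ≤ s := by omega
      simp only [h1, h2, if_false]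
      have := hu (p + (t - s - 1)) (by omega)
      rwa [show p + (t - s - 1) + 1 = p + 1 + (t - s - 1) by omega] at this

variable (N) in
/-- A property of multi-indices is stable under one-element exchanges between sums of bases
below `T`. -/
def ExchangeStable (m : ℕ) (T : Fin n →₀ ℕ) (P : (Fin n →₀ ℕ) → Prop) : Prop :=
  ∀ (I I' : Fin m → Finset (Fin n)), (∀ j, N.IsBase (I j : Set (Fin n))) →
    (∀ j, N.IsBase (I' j : Set (Fin n))) → ∀ u v,
      tupleIndex I' + Finsupp.single u 1 = tupleIndex I + Finsupp.single v 1 →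
      tupleIndex I + Finsupp.single v 1 ≤ T → P (tupleIndex I) → P (tupleIndex I')

/-- All exchanges along a chain without shortcuts can be performed, the last one first. -/
theorem exchange_along_chain (hE : N.E = Set.univ) {T : Fin n →₀ ℕ}
    {P : (Fin n →₀ ℕ) → Prop} (hP : ExchangeStable N m T P) (l : ℕ) (u : ℕ → Fin n)
    (hinj : ∀ s t, s < t → t ≤ l → u s ≠ u t) (I : Fin m → Finset (Fin n))
    (hI : ∀ j, N.IsBase (I j : Set (Fin n)))
    (hedge : ∀ s < l, ExchangeEdge N I (u s) (u (s + 1)))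
    (hshort : ∀ s t, s + 1 < t → t ≤ l → ¬ ExchangeEdge N I (u s) (u t))
    (hT : tupleIndex I + Finsupp.single (u l) 1 ≤ T) (hPI : P (tupleIndex I)) :
    ∃ I' : Fin m → Finset (Fin n), (∀ j, N.IsBase (I' j : Set (Fin n))) ∧
      tupleIndex I' + Finsupp.single (u 0) 1 = tupleIndex I + Finsupp.single (u l) 1 ∧
      P (tupleIndex I') := by
  classical
  induction l generalizing I with
  | zero => exact ⟨I, hI, rfl, hPI⟩
  | succ l ih =>
    obtain ⟨a, hua, hva⟩ := hedge l (Nat.lt_succ_self l)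
    have hsub : ∀ X, X ⊆ N.closure X := fun X => N.subset_closure X (by simp [hE])
    have hvI : u (l + 1) ∉ I a := fun h =>
      hva (hsub _ ⟨by simpa using h, (hinj l (l + 1) (by omega) le_rfl).symm⟩)
    set I₁ := Function.update I a (insert (u (l + 1)) ((I a).erase (u l))) with hI₁
    have hbase : ∀ j, N.IsBase (I₁ j : Set (Fin n)) := by
      intro j
      rcases eq_or_ne j a with rfl | hj
      · rw [hI₁, Function.update_self, Finset.coe_insert, Finset.coe_erase]
        exact (hI j).exchange_base_of_notMem_closure (by simpa using hua) hva
      · rw [hI₁, Function.update_of_ne hj]; exact hI j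
    have hidx : tupleIndex I₁ + Finsupp.single (u l) 1 =
        tupleIndex I + Finsupp.single (u (l + 1)) 1 := tupleIndex_update hua hvI
    -- The absence of a shortcut from `u s` to `u (l + 1)` says that `u (l + 1)` is in the closure
    -- of `I a \ {u s}` whenever `u s ∈ I a`, which is what `closure_exchange_sdiff` needs.
    have hiff : ∀ s < l, ∀ v, ExchangeEdge N I₁ (u s) v ↔ ExchangeEdge N I (u s) v := by
      intro s hs v
      refine exists_congr fun j => ?_
      rcases eq_or_ne j a with rfl | hj
      · have h1 : u s ≠ u l := hinj s l hs (by omega)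
        have h2 : u s ≠ u (l + 1) := hinj s (l + 1) (by omega) le_rfl
        rw [hI₁, Function.update_self]
        simp only [Finset.mem_insert, h2, false_or, Finset.mem_erase, ne_eq, h1,
          not_false_eq_true, true_and, Finset.coe_insert, Finset.coe_erase]
        refine and_congr_right fun hsI => ?_
        rw [closure_exchange_sdiff hE (by simpa using hua) hva (by simpa using hsI) h1]
        by_contra hcl
        exact hshort s (l + 1) (by omega) le_rfl ⟨j, hsI, hcl⟩
      · rw [hI₁, Function.update_of_ne hj]
    -- The multi-index to be bounded is the same at every stage, so the whole chain of trades stays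
    -- below `T`.
    have hle : tupleIndex I₁ + Finsupp.single (u l) 1 ≤ T := hidx ▸ hT
    obtain ⟨I', hI', hidx', hPI'⟩ := ih (fun s t hst ht => hinj s t hst (by omega)) I₁ hbase
      (fun s hs => (hiff s hs _).2 (hedge s (by omega)))
      (fun s t hst ht h => hshort s t hst (by omega) ((hiff s (by omega) _).1 h))
      hle (hP I I₁ hI hbase _ _ hidx hT hPI)
    exact ⟨I', hI', hidx'.trans hidx, hPI'⟩

/-- Any two sums of `m` bases below `T` are connected by one-element exchanges through sums of
`m` bases below `T`. -/
theorem ExchangeStable.of_base_tuple (hE : N.E = Set.univ) {T : Fin n →₀ ℕ}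
    {P : (Fin n →₀ ℕ) → Prop} (hP : ExchangeStable N m T P) {I I' : Fin m → Finset (Fin n)}
    (hI : ∀ j, N.IsBase (I j : Set (Fin n))) (hI' : ∀ j, N.IsBase (I' j : Set (Fin n)))
    (hT : tupleIndex I ≤ T) (hT' : tupleIndex I' ≤ T) (hPI : P (tupleIndex I)) :
    P (tupleIndex I') := by
  classical
  have hsum : ∀ {A B : Fin m → Finset (Fin n)}, (∀ j, N.IsBase (A j : Set (Fin n))) →
      (∀ j, N.IsBase (B j : Set (Fin n))) → ∑ i, tupleIndex A i = ∑ i, tupleIndex B i := by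
    intro A B hA hB
    rw [sum_tupleIndex, sum_tupleIndex]
    refine Finset.sum_congr rfl fun j _ => ?_
    simpa [Set.encard_coe_eq_coe_finsetCard] using (hA j).encard_eq_encard_of_isBase (hB j)
  -- Induction on the total excess; the subtraction is truncated, so only indices with too many
  -- occurrences count.
  induction hd : ∑ i, (tupleIndex I i - tupleIndex I' i) using Nat.strong_induction_on
    generalizing I with
  | _ d ih =>
    by_cases hex : ∃ i, tupleIndex I' i < tupleIndex I i
    · obtain ⟨i, hi⟩ := hex
      obtain ⟨j, hreach, hj⟩ := exists_reachable_deficient hE hI hI' hi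
      obtain ⟨l, u, hu0, hul, hedge, hshort⟩ := exists_chain_without_shortcut hreach
      have hij : i ≠ j := by rintro rfl; omega
      -- A repeated vertex would create a shortcut to the successor of its second occurrence, or, if
      -- that is the end, from the predecessor of the first; the two ends differ because `i ≠ j`.
      have hinj : ∀ s t, s < t → t ≤ l → u s ≠ u t := by
        intro s t hst ht heq
        rcases Nat.lt_or_ge t l with h | h
        · exact hshort s (t + 1) (by omega) h (heq ▸ hedge t h)
        · obtain rfl : t = l := le_antisymm ht h
          rcases Nat.eq_zero_or_pos s with rfl | hs
          · exact hij (by rw [← hu0, ← hul, heq])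
          · refine hshort (s - 1) t (by omega) le_rfl ?_
            have := hedge (s - 1) (by omega)
            rwa [Nat.sub_add_cancel hs, heq] at this
      -- There is room for one more `j`, since `j` occurs less often in `I` than in `I'`, which is
      -- below `T`.
      have hTj : tupleIndex I + Finsupp.single (u l) 1 ≤ T := by
        intro p
        rw [hul, Finsupp.add_apply, Finsupp.single_apply]
        have h1 := hT p
        have h2 := hT' p
        split_ifs with h
        · subst h; omega
        · simpa using h1
      obtain ⟨I₁, hI₁, hidx, hPI₁⟩ :=
        exchange_along_chain hE hP l u hinj I hI hedge hshort hTj hPI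
      rw [hu0, hul] at hidx
      have hval : ∀ p, tupleIndex I₁ p + (if i = p then 1 else 0) =
          tupleIndex I p + (if j = p then 1 else 0) := by
        intro p
        simpa [Finsupp.single_apply] using DFunLike.congr_fun hidx p
      refine ih _ ?_ hI₁ ?_ hPI₁ rfl
      · rw [← hd]
        refine Finset.sum_lt_sum (fun p _ => ?_) ⟨i, Finset.mem_univ _, ?_⟩
        · have := hval p
          split_ifs at this with h1 h2 h2 <;> first | omega | (subst h2; omega)
        · have := hval i
          simp only [if_true, hij.symm, if_false] at this
          omega
      · refine le_trans ?_ (hul ▸ hTj)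
        rw [← hidx]
        exact le_self_add
    · push Not at hex
      have : tupleIndex I = tupleIndex I' := by
        ext i
        by_contra hne
        have := Finset.sum_lt_sum (s := Finset.univ) (fun i _ => hex i)
          ⟨i, Finset.mem_univ _, lt_of_le_of_ne (hex i) hne⟩
        exact absurd (hsum hI hI') this.ne
      rwa [← this]

end Exchange

/-! ### Power series in several variables, indexed by multi-indices -/

section MultiSeries

variable {n : ℕ}

theorem finsupp_degree_eq_sum (T : Fin n →₀ ℕ) : T.degree = ∑ i, T i :=
  Finset.sum_subset (Finset.subset_univ _) (by simp)

/-- The multi-index of a word. -/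
def wordIndex (w : List (Fin n)) : Fin n →₀ ℕ :=
  Multiset.toFinsupp (w : Multiset (Fin n))

@[simp] theorem wordIndex_nil : wordIndex ([] : List (Fin n)) = 0 := by
  simp [wordIndex]

theorem wordIndex_append (v w : List (Fin n)) : wordIndex (v ++ w) = wordIndex v + wordIndex w := by
  rw [wordIndex, ← Multiset.coe_add, map_add]; rfl

theorem wordIndex_cons (i : Fin n) (w : List (Fin n)) :
    wordIndex (i :: w) = Finsupp.single i 1 + wordIndex w := by
  rw [← List.singleton_append, wordIndex_append]
  congr 1
  simp [wordIndex]

@[simp] theorem wordIndex_multiWord (T : Fin n →₀ ℕ) : wordIndex (multiWord T) = T := by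
  simp [wordIndex, multiWord]

theorem multiWord_setIndex (I : Finset (Fin n)) : multiWord (setIndex I) = I.sort (· ≤ ·) := by
  have : Finsupp.toMultiset (setIndex I) = I.val := by
    rw [setIndex, map_sum]
    simp [Finset.sum_multiset_singleton]
  rw [multiWord, this]
  rfl

@[simp] theorem wordIndex_sort (I : Finset (Fin n)) : wordIndex (I.sort (· ≤ ·)) = setIndex I := by
  rw [← multiWord_setIndex, wordIndex_multiWord]

theorem prod_map_eq_prod_pow (w : List (Fin n)) (y : Fin n → ℂ) :
    (w.map y).prod = ∏ i, y i ^ wordIndex w i := by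
  induction w with
  | nil => simp
  | cons i w ih =>
    rw [List.map_cons, List.prod_cons, ih, wordIndex_cons]
    simp only [Finsupp.add_apply, pow_add, Finset.prod_mul_distrib, Finsupp.single_apply]
    congr 1
    simp [Finset.prod_ite_eq, pow_ite]

theorem length_multiWord (T : Fin n →₀ ℕ) : (multiWord T).length = T.degree := by
  rw [multiWord, Multiset.length_sort, Finsupp.card_toMultiset]
  rfl

theorem multiFactorial_add_single (T : Fin n →₀ ℕ) (i : Fin n) :
    multiFactorial (T + Finsupp.single i 1) = (T i + 1) * multiFactorial T := by
  classical
  unfold multiFactorial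
  rw [← Finset.mul_prod_erase _ _ (Finset.mem_univ i),
    ← Finset.mul_prod_erase _ (fun j => (T j).factorial) (Finset.mem_univ i), ← mul_assoc]
  congr 1
  · simp [Nat.factorial_succ]
  · refine Finset.prod_congr rfl fun j hj => ?_
    simp [(Finset.ne_of_mem_erase hj).symm]

theorem multiFactorial_ne_zero (T : Fin n →₀ ℕ) : (multiFactorial T : ℂ) ≠ 0 := by
  unfold multiFactorial
  exact_mod_cast Finset.prod_ne_zero_iff.2 fun i _ => Nat.factorial_ne_zero _

@[simp] theorem multiFactorial_zero : multiFactorial (0 : Fin n →₀ ℕ) = 1 := by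
  simp [multiFactorial]

theorem multiPow_add (z x : Fin n → ℂ) (S T : Fin n →₀ ℕ) :
    multiPow z x (S + T) = multiPow z x S * multiPow z x T := by
  simp [multiPow, pow_add, Finset.prod_mul_distrib]

theorem norm_multiPow_le {z x : Fin n → ℂ} {r : ℝ} (h : dist z x ≤ r) (T : Fin n →₀ ℕ) :
    ‖multiPow z x T‖ ≤ r ^ T.degree := by
  rw [multiPow, norm_prod, finsupp_degree_eq_sum, ← Finset.prod_pow_eq_pow_sum]
  refine Finset.prod_le_prod (fun _ _ => norm_nonneg _) fun i _ => ?_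
  rw [norm_pow]
  refine pow_le_pow_left₀ (norm_nonneg _) ?_ _
  rw [← dist_eq_norm]
  exact (dist_le_pi_dist z x i).trans h

/-- On the polydisc of radius `r` around `x`, the function `f` is the sum of the power series with
coefficients `c`. -/
def HasMultiSeries (f : (Fin n → ℂ) → ℂ) (x : Fin n → ℂ) (c : (Fin n →₀ ℕ) → ℂ) (r : ℝ) : Prop :=
  ∀ z ∈ Metric.ball x r, HasSum (fun T => c T * multiPow z x T) (f z)

namespace HasMultiSeries

variable {f g : (Fin n → ℂ) → ℂ} {x : Fin n → ℂ} {c d : (Fin n →₀ ℕ) → ℂ} {r : ℝ}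

theorem mono (h : HasMultiSeries f x c r) {s : ℝ} (hs : s ≤ r) : HasMultiSeries f x c s :=
  fun z hz => h z (Metric.ball_subset_ball hs hz)

theorem congr (h : HasMultiSeries f x c r) (hfg : Set.EqOn f g (Metric.ball x r)) :
    HasMultiSeries g x c r :=
  fun z hz => hfg hz ▸ h z hz

theorem congr_coeff (h : HasMultiSeries f x c r) (hcd : ∀ T, c T = d T) :
    HasMultiSeries f x d r :=
  funext hcd ▸ h

theorem eqOn (hf : HasMultiSeries f x c r) (hg : HasMultiSeries g x c r) :
    Set.EqOn f g (Metric.ball x r) :=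
  fun z hz => (hf z hz).unique (hg z hz)

/-- Evaluate at x + (s, …, s), which lies in the polydisc because the norm is the sup norm; a
convergent unconditional sum in ℂ converges absolutely. -/
theorem summable_norm (h : HasMultiSeries f x c r) {s : ℝ} (hs0 : 0 ≤ s) (hs : s < r) :
    Summable fun T => ‖c T‖ * s ^ T.degree := by
  have hz : (fun i => x i + s) ∈ Metric.ball x r := by
    rw [Metric.mem_ball]
    refine lt_of_le_of_lt ((dist_pi_le_iff hs0).2 fun i => ?_) hs
    simp [abs_of_nonneg hs0]
  convert (h _ hz).summable.norm using 2 with T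
  rw [norm_mul, multiPow, norm_prod, finsupp_degree_eq_sum, ← Finset.prod_pow_eq_pow_sum]
  simp [abs_of_nonneg hs0]

theorem coeff_zero (h : HasMultiSeries f x c r) (hr : 0 < r) : f x = c 0 := by
  refine (h x (Metric.mem_ball_self hr)).unique ?_
  convert hasSum_single (0 : Fin n →₀ ℕ) (f := fun T => c T * multiPow x x T) ?_ using 1
  · simp [multiPow]
  · intro T hT
    obtain ⟨i, hi⟩ : ∃ i, T i ≠ 0 := by
      by_contra! hcon
      exact hT (Finsupp.ext hcon)
    have : multiPow x x T = 0 := Finset.prod_eq_zero (Finset.mem_univ i) (by simp [hi])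
    simp [this]

/-- Grouping the terms by degree gives a formal multilinear series. Each monomial becomes a product
of coordinate projections, a form of norm at most 1, so absolute summability at a radius `s < r`
bounds the radius of convergence from below. -/
theorem analyticAt (h : HasMultiSeries f x c r) {z : Fin n → ℂ} (hz : z ∈ Metric.ball x r) :
    AnalyticAt ℂ f z := by
  classical
  obtain ⟨s, hzs, hsr⟩ := exists_between (Metric.mem_ball.1 hz)
  have hs0 : 0 < s := dist_nonneg.trans_lt hzs
  let form : (T : Fin n →₀ ℕ) → (k : ℕ) → ContinuousMultilinearMap ℂ
      (fun _ : Fin k => Fin n → ℂ) ℂ := fun T k =>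
    if hk : (multiWord T).length = k then
      (ContinuousMultilinearMap.mkPiAlgebra ℂ (Fin k) ℂ).compContinuousLinearMap fun j =>
        ContinuousLinearMap.proj ((multiWord T)[(Fin.cast hk.symm j)])
    else 0
  have form_norm : ∀ T k, ‖form T k‖ ≤ 1 := by
    intro T k
    by_cases hk : (multiWord T).length = k
    · simp only [form, hk, dif_pos]
      refine (ContinuousMultilinearMap.norm_compContinuousLinearMap_le _ _).trans ?_
      rw [ContinuousMultilinearMap.norm_mkPiAlgebra, one_mul]
      refine Finset.prod_le_one (fun _ _ => norm_nonneg _) fun j _ => ?_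
      refine ContinuousLinearMap.opNorm_le_bound _ zero_le_one fun y => ?_
      rw [one_mul]
      exact norm_le_pi_norm y _
    · simp [form, hk]
  have form_apply : ∀ (T : Fin n →₀ ℕ) (y : Fin n → ℂ),
      form T T.degree (fun _ => y) = ∏ i, y i ^ T i := by
    intro T y
    have hk := length_multiWord T
    rw [← wordIndex_multiWord T, ← prod_map_eq_prod_pow, wordIndex_multiWord]
    simp only [form, hk, dif_pos, ContinuousMultilinearMap.compContinuousLinearMap_apply,
      ContinuousMultilinearMap.mkPiAlgebra_apply, ContinuousLinearMap.proj_apply]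
    rw [← Fin.prod_univ_fun_getElem]
    exact (Fintype.prod_equiv (finCongr hk) _ _ fun j => by simp).symm
  let p : FormalMultilinearSeries ℂ (Fin n → ℂ) ℂ := fun k =>
    ∑ T ∈ Finset.univ.finsuppAntidiag k, c T • form T k
  have hmem : ∀ k (T : Fin n →₀ ℕ), T ∈ Finset.univ.finsuppAntidiag k ↔ T.degree = k := by
    intro k T
    simp [finsupp_degree_eq_sum]
  have hset : ∀ k, Finsupp.degree ⁻¹' {k} =
      ((Finset.univ.finsuppAntidiag k : Finset (Fin n →₀ ℕ)) : Set (Fin n →₀ ℕ)) := by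
    intro k; ext T; simp [finsupp_degree_eq_sum]
  have hsum := h.summable_norm hs0.le hsr
  have hpow : HasFPowerSeriesOnBall f p x (ENNReal.ofReal s) := by
    refine ⟨?_, by simpa using hs0, ?_⟩
    · refine p.le_radius_of_summable_norm ?_
      rw [Real.coe_toNNReal _ hs0.le]
      refine Summable.of_nonneg_of_le (fun k => by positivity) (fun k => ?_)
        (hsum.hasSum.tsum_fiberwise Finsupp.degree).summable
      rw [hset, Finset.tsum_subtype' _ (fun T : Fin n →₀ ℕ => ‖c T‖ * s ^ T.degree)]
      refine (mul_le_mul_of_nonneg_right (norm_sum_le _ _) (by positivity)).trans ?_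
      rw [Finset.sum_mul]
      refine Finset.sum_le_sum fun T hT => ?_
      rw [norm_smul, (hmem k T).1 hT]
      gcongr
      exact mul_le_of_le_one_right (norm_nonneg _) (form_norm T k)
    · intro y hy
      have hy' : x + y ∈ Metric.ball x r := by
        rw [Metric.mem_ball, dist_self_add_left]
        rw [Metric.mem_eball, edist_zero_right, ← ofReal_norm,
          ENNReal.ofReal_lt_ofReal_iff hs0] at hy
        exact hy.trans hsr
      convert (h _ hy').tsum_fiberwise Finsupp.degree using 2 with k
      rw [hset, Finset.tsum_subtype' _ (fun T : Fin n →₀ ℕ => c T * multiPow (x + y) x T)]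
      simp only [p, sum_apply, smul_apply]
      refine Finset.sum_congr rfl fun T hT => ?_
      obtain rfl := (hmem k T).1 hT
      rw [form_apply]
      simp [multiPow]
  refine hpow.analyticAt_of_mem ?_
  rw [Metric.mem_eball, edist_dist]
  exact (ENNReal.ofReal_lt_ofReal_iff hs0).2 hzs

theorem analyticOnNhd (h : HasMultiSeries f x c r) : AnalyticOnNhd ℂ f (Metric.ball x r) :=
  fun _ hz => h.analyticAt hz

/-- The derivative of a power series. -/
theorem partialDeriv (h : HasMultiSeries f x c r) (i : Fin n) :
    HasMultiSeries (partialDeriv i f) x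
      (fun T => (T i + 1) * c (T + Finsupp.single i 1)) r := by
  classical
  intro z hz
  obtain ⟨s, hzs, hsr⟩ := exists_between (Metric.mem_ball.1 hz)
  have hs0 : 0 < s := dist_nonneg.trans_lt hzs
  -- Restricting to a complex line in direction `i` reduces to termwise differentiation of a
  -- normally convergent series in one variable.
  let line : ℂ → (Fin n → ℂ) := fun t => z + t • Pi.single i 1
  have hline : HasDerivAt line (Pi.single i 1) 0 := by
    have := ((hasDerivAt_id (0 : ℂ)).smul_const (Pi.single i 1 : Fin n → ℂ)).const_add z
    simpa [line] using this
  have hline0 : line 0 = z := by simp [line]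
  have hcont : Continuous line := by fun_prop
  let V : Set ℂ := line ⁻¹' Metric.ball x s
  have hV : IsOpen V := Metric.isOpen_ball.preimage hcont
  have h0V : (0 : ℂ) ∈ V := by simpa [V, hline0] using hzs
  have hpow : ∀ (T : Fin n →₀ ℕ) (t : ℂ), multiPow (line t) x T =
      (z i - x i + t) ^ T i * ∏ j ∈ Finset.univ.erase i, (z j - x j) ^ T j := by
    intro T t
    rw [multiPow, ← Finset.mul_prod_erase _ _ (Finset.mem_univ i)]
    congr 1
    · simp [line, add_sub_right_comm]
    · refine Finset.prod_congr rfl fun j hj => ?_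
      simp [line, Finset.ne_of_mem_erase hj]
  have hder : ∀ T : Fin n →₀ ℕ, HasDerivAt (fun t => c T * multiPow (line t) x T)
      (c T * (T i * (z i - x i) ^ (T i - 1) *
        ∏ j ∈ Finset.univ.erase i, (z j - x j) ^ T j)) 0 := by
    intro T
    simp only [hpow]
    have := (((((hasDerivAt_id (0 : ℂ)).const_add (z i - x i)).pow (T i)).mul_const
      (∏ j ∈ Finset.univ.erase i, (z j - x j) ^ T j)).const_mul (c T))
    simpa using this
  have hdiff : ∀ T : Fin n →₀ ℕ, DifferentiableOn ℂ (fun t => c T * multiPow (line t) x T) V := by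
    intro T
    simp only [hpow]
    fun_prop
  have hsum := Complex.hasSum_deriv_of_summable_norm (h.summable_norm hs0.le hsr) hdiff hV
    (fun T t ht => by
      rw [norm_mul]
      exact mul_le_mul_of_nonneg_left (norm_multiPow_le (le_of_lt ht) T) (norm_nonneg _)) h0V
  have hval : deriv (fun t => ∑' T, c T * multiPow (line t) x T) 0 = _root_.partialDeriv i f z := by
    have heq : (fun t => ∑' T, c T * multiPow (line t) x T) =ᶠ[nhds 0] f ∘ line := by
      filter_upwards [hV.mem_nhds h0V] with t ht
      exact (h _ (Metric.ball_subset_ball hsr.le ht)).tsum_eq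
    rw [heq.deriv_eq]
    have hf := (h.analyticAt hz).differentiableAt.hasFDerivAt
    rw [← hline0] at hf
    rw [(hf.comp_hasDerivAt (0 : ℂ) hline).deriv, hline0]
    rfl
  rw [hval] at hsum
  -- Shift the index by e_i: the terms with `T i = 0`, outside the range of the shift, have
  -- derivative zero.
  have hinj : Function.Injective fun T : Fin n →₀ ℕ => T + Finsupp.single i 1 :=
    add_left_injective _
  rw [← hinj.hasSum_iff] at hsum
  · refine Eq.mp (congrArg (HasSum · _) (funext fun T : Fin n →₀ ℕ => ?_)) hsum
    rw [Function.comp_apply, (hder _).deriv, multiPow,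
      ← Finset.mul_prod_erase _ _ (Finset.mem_univ i)]
    have : ∏ j ∈ Finset.univ.erase i, (z j - x j) ^ (T + Finsupp.single i 1 : Fin n →₀ ℕ) j =
        ∏ j ∈ Finset.univ.erase i, (z j - x j) ^ T j :=
      Finset.prod_congr rfl fun j hj => by simp [(Finset.ne_of_mem_erase hj).symm]
    rw [this]
    simp only [Finsupp.add_apply, Finsupp.single_eq_same, Nat.add_sub_cancel]
    push_cast
    ring
  · intro T hT
    have hTi : T i = 0 := by
      by_contra hne
      refine hT ⟨T - Finsupp.single i 1, tsub_add_cancel_of_le ?_⟩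
      rw [Finsupp.single_le_iff]
      omega
    rw [(hder T).deriv]
    simp [hTi]

/-- Iterated derivatives of a power series. -/
theorem partialWord (h : HasMultiSeries f x c r) (w : List (Fin n)) :
    HasMultiSeries (partialWord w f) x (fun T => (multiFactorial (T + wordIndex w) : ℂ) /
      multiFactorial T * c (T + wordIndex w)) r := by
  induction w with
  | nil =>
    exact h.congr_coeff fun T => by simp [div_self (multiFactorial_ne_zero T)]
  | cons i w ih =>
    refine (ih.partialDeriv i).congr_coeff fun T => ?_
    have h1 : T + wordIndex (i :: w) = T + Finsupp.single i 1 + wordIndex w := by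
      rw [wordIndex_cons, add_assoc]
    rw [h1, multiFactorial_add_single T i]
    have h2 := multiFactorial_ne_zero T
    have h3 : (T i + 1 : ℂ) ≠ 0 := Nat.cast_add_one_ne_zero (T i)
    push_cast
    field_simp

theorem partialWord_apply_center (h : HasMultiSeries f x c r) (hr : 0 < r) (w : List (Fin n)) :
    _root_.partialWord w f x = multiFactorial (wordIndex w) * c (wordIndex w) := by
  rw [(h.partialWord w).coeff_zero hr]
  simp

theorem partialMulti_apply_center (h : HasMultiSeries f x c r) (hr : 0 < r) (T : Fin n →₀ ℕ) :
    partialMulti T f x = multiFactorial T * c T := by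
  rw [partialMulti, h.partialWord_apply_center hr, wordIndex_multiWord]

/-- The coefficients of a power series are unique. -/
theorem coeff_unique (hf : HasMultiSeries f x c r) (hf' : HasMultiSeries f x d r) (hr : 0 < r) :
    c = d := by
  funext T
  have := (hf.partialMulti_apply_center hr T).symm.trans (hf'.partialMulti_apply_center hr T)
  exact mul_left_cancel₀ (multiFactorial_ne_zero T) this

end HasMultiSeries

/-- An analytic function is the sum of a power series on a polydisc. -/
theorem AnalyticAt.exists_hasMultiSeries {f : (Fin n → ℂ) → ℂ} {x : Fin n → ℂ}
    (hf : AnalyticAt ℂ f x) : ∃ r > 0, ∃ c, HasMultiSeries f x c r := by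
  classical
  obtain ⟨p, R, hp⟩ := hf
  obtain ⟨t, ht0, htR⟩ := ENNReal.lt_iff_exists_nnreal_btwn.1 hp.r_pos
  have ht0' : (0 : ℝ) < t := by exact_mod_cast ht0
  have hn : (0 : ℝ) < n + 1 := by positivity
  -- The degree-`k` part has `n ^ k` coefficients on basis vectors, each at most `‖p k‖`, so
  -- absolute convergence requires `n * s ≤ t`; the `+ 1` covers `n = 0`.
  let s : ℝ := t / (n + 1)
  have hs0 : 0 < s := by positivity
  have hns : n * s ≤ t := by
    simp only [s]
    rw [mul_div_assoc', div_le_iff₀ hn]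
    nlinarith
  have hst : s ≤ t := div_le_self ht0'.le (by simp)
  let q : (Σ k, Fin k → Fin n) → ℂ := fun b => p b.1 fun j => Pi.single (b.2 j) 1
  let idx : (Σ k, Fin k → Fin n) → (Fin n →₀ ℕ) := fun b => wordIndex (List.ofFn b.2)
  -- The coefficient of a multi-index collects all words that have it as their index.
  refine ⟨s, hs0, fun T => ∑' b : idx ⁻¹' {T}, q b, fun z hz => ?_⟩
  let y : Fin n → ℂ := fun i => z i - x i
  have hyz : x + y = z := by ext i; simp [y]
  have hy : ∀ i, ‖y i‖ ≤ s := fun i => by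
    simp only [y]
    rw [← dist_eq_norm]
    exact (dist_le_pi_dist z x i).trans (Metric.mem_ball.1 hz).le
  have hprod : ∀ b : Σ k, Fin k → Fin n, ∏ j, y (b.2 j) = multiPow z x (idx b) := by
    intro b
    simp only [multiPow, idx]
    rw [← prod_map_eq_prod_pow (List.ofFn b.2) y, List.map_ofFn, List.prod_ofFn]
    rfl
  have hsummable : Summable fun b : Σ k, Fin k → Fin n => q b * ∏ j, y (b.2 j) := by
    refine Summable.of_norm ?_
    have hb : ∀ b : Σ k, Fin k → Fin n, ‖q b * ∏ j, y (b.2 j)‖ ≤ ‖p b.1‖ * s ^ b.1 := by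
      intro b
      rw [norm_mul, norm_prod]
      refine mul_le_mul ?_ ?_ (by positivity) (norm_nonneg _)
      · refine ((p b.1).le_opNorm _).trans ?_
        simp [Pi.norm_single]
      · calc ∏ j, ‖y (b.2 j)‖ ≤ ∏ _j : Fin b.1, s :=
              Finset.prod_le_prod (fun _ _ => norm_nonneg _) fun j _ => hy _
          _ = s ^ b.1 := by simp
    refine Summable.of_nonneg_of_le (fun _ => norm_nonneg _) hb ?_
    refine (summable_sigma_of_nonneg fun b => by positivity).2
      ⟨fun k => Summable.of_finite, ?_⟩
    have : ∀ k : ℕ, ∑' _ : Fin k → Fin n, ‖p k‖ * s ^ k = ‖p k‖ * (n * s) ^ k := by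
      intro k
      rw [tsum_fintype]
      simp [mul_pow]
      ring
    simp only [this]
    refine Summable.of_nonneg_of_le (fun k => by positivity) (fun k => ?_)
      (p.summable_norm_mul_pow (htR.trans_le hp.r_le))
    gcongr
  have hmain : HasSum (fun b : Σ k, Fin k → Fin n => q b * ∏ j, y (b.2 j)) (f z) := by
    have hyR : y ∈ Metric.eball (0 : Fin n → ℂ) R := by
      rw [Metric.mem_eball, edist_zero_right, ← ofReal_norm]
      refine lt_of_le_of_lt ?_ htR
      rw [← ENNReal.ofReal_coe_nnreal]
      refine ENNReal.ofReal_le_ofReal ?_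
      exact ((pi_norm_le_iff_of_nonneg hs0.le).2 hy).trans hst
    have h1 := hp.hasSum hyR
    rw [hyz] at h1
    refine h1.sigma_of_hasSum (fun k => ?_) hsummable
    have h2 : (fun _ : Fin k => y) = fun _ => ∑ i, y i • (Pi.single i (1 : ℂ) : Fin n → ℂ) := by
      funext _
      exact (pi_eq_sum_univ' y).trans (by simp)
    rw [h2, ContinuousMultilinearMap.map_sum]
    convert hasSum_fintype _ using 2 with w
    rw [ContinuousMultilinearMap.map_smul_univ, smul_eq_mul, mul_comm]
  have hfib : ∀ T, (∑' b : idx ⁻¹' {T}, q b) * multiPow z x T =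
      ∑' b : idx ⁻¹' {T}, q b * ∏ j, y (b.1.2 j) := by
    intro T
    rw [← tsum_mul_right]
    refine tsum_congr fun b => ?_
    rw [hprod, show idx b = T from b.2]
  simp only [hfib]
  exact hmain.tsum_fiberwise idx

end MultiSeries

/-! ### Functions on open subsets of `ℂⁿ` -/

section OpenSubset

variable {n : ℕ} {M : Opens (Fin n → ℂ)}

/-- The chart of an open subset is the inclusion, so in this chart the function coincides with `g`
near `x`. -/
theorem hasMFDerivAt_comp_subtype_val {g : (Fin n → ℂ) → ℂ} {x : M}
    (hg : DifferentiableAt ℂ g x) :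
    HasMFDerivAt 𝓘(ℂ, Fin n → ℂ) 𝓘(ℂ) (fun y : M => g y) x
      (fderiv ℂ g (x : Fin n → ℂ)) := by
  have hchart : ∀ z : M, extChartAt 𝓘(ℂ, Fin n → ℂ) x z = (z : Fin n → ℂ) := fun z => rfl
  refine ⟨hg.continuousAt.comp continuous_subtype_val.continuousAt, ?_⟩
  suffices h : HasFDerivAt (writtenInExtChartAt 𝓘(ℂ, Fin n → ℂ) 𝓘(ℂ) x fun y : M => g y)
      (fderiv ℂ g (x : Fin n → ℂ)) (x : Fin n → ℂ) from h.hasFDerivWithinAt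
  refine hg.hasFDerivAt.congr_of_eventuallyEq ?_
  have htarget : ∀ᶠ y in nhds (x : Fin n → ℂ), y ∈ (extChartAt 𝓘(ℂ, Fin n → ℂ) x).target := by
    have := extChartAt_target_mem_nhds (I := 𝓘(ℂ, Fin n → ℂ)) x
    rwa [hchart] at this
  filter_upwards [htarget] with y hy
  have hinv := (extChartAt 𝓘(ℂ, Fin n → ℂ) x).right_inv hy
  rw [hchart] at hinv
  simp only [writtenInExtChartAt, extChartAt_self_eq, Function.comp_apply,
    modelWithCornersSelf_coe, id_eq]
  exact congrArg g hinv

theorem extend_val_comp (f : M → ℂ) :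
    (fun y : M => Function.extend Subtype.val f 0 (y : Fin n → ℂ)) = f :=
  funext fun _ => Subtype.val_injective.extend_apply _ _ _

theorem analyticAt_extend {f : M → ℂ} (hf : ContMDiff 𝓘(ℂ, Fin n → ℂ) 𝓘(ℂ) ω f) (x : M) :
    AnalyticAt ℂ (Function.extend Subtype.val f 0) x := by
  have h : ContMDiffAt 𝓘(ℂ, Fin n → ℂ) 𝓘(ℂ) ω (Function.extend Subtype.val f 0)
      (x : Fin n → ℂ) := by
    rw [← contMDiffAt_subtype_iff, extend_val_comp]
    exact hf x
  exact h.contDiffAt.analyticAt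

theorem partialDeriv_extend {f : M → ℂ} (hf : ContMDiff 𝓘(ℂ, Fin n → ℂ) 𝓘(ℂ) ω f) (i : Fin n)
    (x : M) : partialDeriv i (Function.extend Subtype.val f 0) x =
      mfderiv 𝓘(ℂ, Fin n → ℂ) 𝓘(ℂ) f x (coordField i x) := by
  have h := (hasMFDerivAt_comp_subtype_val (analyticAt_extend hf x).differentiableAt).mfderiv
  rw [extend_val_comp] at h
  rw [h]
  rfl

end OpenSubset

/-! ### Words in the Higgs field -/

section Higgs

variable {n : ℕ} {M : Opens (Fin n → ℂ)}
  {K : M → Type*}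
  [∀ x, AddCommGroup (K x)] [∀ x, Module ℂ (K x)] [∀ x, TopologicalSpace (K x)]
  [∀ x, IsTopologicalAddGroup (K x)] [∀ x, ContinuousSMul ℂ (K x)]
  (C : Π x : M, TangentSpace 𝓘(ℂ, Fin n → ℂ) x →L[ℂ] K x →L[ℂ] K x)

theorem higgsWord_cons (i : Fin n) (w : List (Fin n)) (x : M) :
    higgsWord C (i :: w) x = C x (coordField i x) * higgsWord C w x := by
  simp [higgsWord]

theorem higgsWord_append (v w : List (Fin n)) (x : M) :
    higgsWord C (v ++ w) x = higgsWord C v x * higgsWord C w x := by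
  simp [higgsWord]

theorem higgsMulti_zero (x : M) : higgsMulti C 0 x = 1 := by
  simp [higgsMulti, multiWord, higgsWord]

variable {C} {x : M}

theorem higgsWord_perm
    (hC : ∀ X Y : TangentSpace 𝓘(ℂ, Fin n → ℂ) x, C x X * C x Y = C x Y * C x X)
    {v w : List (Fin n)} (h : v.Perm w) :
    higgsWord C v x = higgsWord C w x := by
  induction h with
  | nil => rfl
  | cons i _ ih => rw [higgsWord_cons, higgsWord_cons, ih]
  | swap i j l => simp only [higgsWord_cons, ← mul_assoc, hC]
  | trans _ _ h₁ h₂ => exact h₁.trans h₂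

theorem higgsMulti_add
    (hC : ∀ X Y : TangentSpace 𝓘(ℂ, Fin n → ℂ) x, C x X * C x Y = C x Y * C x X)
    (S T : Fin n →₀ ℕ) :
    higgsMulti C (S + T) x = higgsMulti C S x * higgsMulti C T x := by
  rw [higgsMulti, higgsMulti, higgsMulti, ← higgsWord_append]
  refine higgsWord_perm hC (Multiset.coe_eq_coe.1 ?_)
  rw [← Multiset.coe_add]
  simp [multiWord]

end Higgs

/-! ### Matrix elements of a Frobenius like structure -/

namespace FrobeniusLikeStructure

variable {n k m : ℕ} {M : Opens (Fin n → ℂ)}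
  {F : Type*} [NormedAddCommGroup F] [NormedSpace ℂ F]
  {K : M → Type*} [TopologicalSpace (TotalSpace F K)]
  [∀ x, AddCommGroup (K x)] [∀ x, Module ℂ (K x)] [∀ x, TopologicalSpace (K x)]
  [∀ x, IsTopologicalAddGroup (K x)] [∀ x, ContinuousSMul ℂ (K x)]
  [FiberBundle F K] [VectorBundle ℂ F K]
  (D : FrobeniusLikeStructure k m M F K)

theorem higgsMulti_single (i : Fin n) (x : M) :
    higgsMulti D.C (Finsupp.single i 1) x = D.C x (coordField i x) := by
  simp [higgsMulti, multiWord, higgsWord]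

/-- The form `S` is invariant under words in the Higgs field. -/
theorem S_higgsWord (x : M) (w : List (Fin n)) (s : Fin m → K x) (a b : Fin m) :
    D.S x (Function.update s a (higgsWord D.C w x (s a))) =
      D.S x (Function.update s b (higgsWord D.C w x (s b))) := by
  rcases eq_or_ne a b with rfl | hab
  · rfl
  induction w generalizing s with
  | nil => simp [higgsWord]
  | cons i w ih =>
    have hcomm : higgsWord D.C (i :: w) x = higgsWord D.C w x * D.C x (coordField i x) := by
      rw [← List.singleton_append, higgsWord_perm (D.C_comm x) List.perm_append_comm,
        higgsWord_append]
      simp [higgsWord]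
    -- Move the letter `i` alone to slot `b`, then the rest of the word by induction; the letters
    -- arrive in another order, which `hcomm` repairs.
    have h1 := D.S_higgs x (coordField i x)
      (Function.update s a (higgsWord D.C w x (s a))) a b
    rw [Function.update_self, Function.update_idem, Function.update_of_ne hab.symm,
      Function.update_comm hab] at h1
    have h2 := ih (Function.update s b (D.C x (coordField i x) (s b)))
    rw [Function.update_self, Function.update_idem, Function.update_of_ne hab] at h2
    rw [higgsWord_cons]
    exact h1.trans (h2.trans (by rw [← higgsWord_cons, hcomm]; rfl))

/-- All Higgs fields can be collected in the first argument of `S`. -/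
theorem S_higgsMulti [NeZero m] (x : M) (T : Fin m → Fin n →₀ ℕ) (s : Fin m → K x) :
    D.S x (fun j => higgsMulti D.C (T j) x (s j)) =
      D.S x (Function.update s 0 (higgsMulti D.C (∑ j, T j) x (s 0))) := by
  classical
  -- Only the slots in `t` carry fields, so they can be emptied into slot 0 one at a time.
  suffices h : ∀ (t : Finset (Fin m)) (s : Fin m → K x),
      D.S x (fun j => if j ∈ t then higgsMulti D.C (T j) x (s j) else s j) =
        D.S x (Function.update s 0 (higgsMulti D.C (∑ j ∈ t, T j) x (s 0))) by
    simpa using h Finset.univ s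
  intro t
  induction t using Finset.induction_on with
  | empty => intro s; simp [higgsMulti_zero]
  | insert b t hb ih =>
    intro s
    have hcomm : ∀ (A B : Fin n →₀ ℕ) (v : K x), higgsMulti D.C A x (higgsMulti D.C B x v) =
        higgsMulti D.C (A + B) x v := by
      intro A B v
      rw [higgsMulti_add (D.C_comm x)]; rfl
    have h1 := D.S_higgsWord x (multiWord (T b))
      (fun j => if j ∈ t then higgsMulti D.C (T j) x (s j) else s j) b 0
    have h2 := ih (Function.update s 0 (higgsMulti D.C (T b) x (s 0)))
    rw [Function.update_self, Function.update_idem, hcomm] at h2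
    rw [Finset.sum_insert hb, add_comm (T b), ← h2]
    convert h1 using 2
    · funext j
      rcases eq_or_ne j b with rfl | hj
      · simp [hb, higgsMulti]
      · simp [hj]
    · funext j
      rcases eq_or_ne j 0 with rfl | hj
      · by_cases h0 : (0 : Fin m) ∈ t
        · simp only [h0, if_true, Function.update_self]
          rw [hcomm, add_comm, ← hcomm]
          rfl
        · simp [h0, higgsMulti]
      · simp [hj]

theorem isHolSectionOn_higgsWord (w : List (Fin n)) :
    IsHolSectionOn F (fun x => higgsWord D.C w x (D.ζ x)) ((⊤ : Opens M) : Set M) := by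
  induction w with
  | nil => simpa [higgsWord] using D.ζ_hol
  | cons i w ih =>
    simp only [higgsWord_cons]
    exact D.C_hol ⊤ _ ih i

theorem contMDiff_S {σ : Fin m → Π x : M, K x}
    (hσ : ∀ a, IsHolSectionOn F (σ a) ((⊤ : Opens M) : Set M)) :
    ContMDiff 𝓘(ℂ, Fin n → ℂ) 𝓘(ℂ) ω (fun x => D.S x fun a => σ a x) := by
  have := D.S_hol ⊤ σ hσ
  rwa [Opens.coe_top, contMDiffOn_univ] at this

theorem higgsSet_eq_higgsMulti (I : Finset (Fin n)) (x : M) :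
    higgsSet D.C I x = higgsMulti D.C (setIndex I) x := by
  rw [higgsSet, higgsMulti, multiWord_setIndex]

theorem covCoord_higgsSet {I : Finset (Fin n)} (hI : D.matroid.IsBase (I : Set (Fin n)))
    (i : Fin n) (x : M) : covCoord D.conn i (fun y => higgsSet D.C I y (D.ζ y)) x = 0 := by
  rw [covCoord, D.flat_base I hI x]
  rfl

variable [NeZero m]

theorem contMDiff_matrixElement (T : Fin n →₀ ℕ) :
    ContMDiff 𝓘(ℂ, Fin n → ℂ) 𝓘(ℂ) ω (D.matrixElement T) := by
  have h := D.contMDiff_S (σ := Function.update (fun _ => D.ζ) 0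
    (fun x => higgsWord D.C (multiWord T) x (D.ζ x))) (fun a => by
      rcases eq_or_ne a 0 with rfl | ha
      · rw [Function.update_self]; exact D.isHolSectionOn_higgsWord _
      · rw [Function.update_of_ne ha]; simpa using D.ζ_hol)
  convert h using 2 with x
  unfold matrixElement
  congr 1
  funext a
  rcases eq_or_ne a 0 with rfl | ha
  · simp [higgsMulti]
  · simp [ha]

/-- This is why sums of bases, rather than tuples of bases, can index the coefficients. -/
theorem matrixElement_tupleIndex (I : Fin m → Finset (Fin n)) (x : M) :
    D.matrixElement (tupleIndex I) x = D.S x fun j => higgsSet D.C (I j) x (D.ζ x) := by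
  simp only [higgsSet_eq_higgsMulti]
  exact (D.S_higgsMulti x (fun j => setIndex (I j)) fun _ => D.ζ x).symm

theorem matrixElement_tupleIndex_add_single (I : Fin m → Finset (Fin n)) (i : Fin n) (x : M) :
    D.matrixElement (tupleIndex I + Finsupp.single i 1) x =
      D.S x (Function.update (fun j => higgsSet D.C (I j) x (D.ζ x)) 0
        (D.C x (coordField i x) (higgsSet D.C (I 0) x (D.ζ x)))) := by
  classical
  have h := D.S_higgsMulti x (Function.update (fun j => setIndex (I j)) 0
    (Finsupp.single i 1 + setIndex (I 0))) fun _ => D.ζ x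
  have hsum : ∑ j, Function.update (fun j => setIndex (I j)) 0
      (Finsupp.single i 1 + setIndex (I 0)) j = tupleIndex I + Finsupp.single i 1 := by
    rw [tupleIndex, ← Finset.add_sum_erase _ _ (Finset.mem_univ (0 : Fin m)),
      ← Finset.add_sum_erase _ (fun j => setIndex (I j)) (Finset.mem_univ (0 : Fin m)),
      Function.update_self, add_comm _ (Finsupp.single i 1), ← add_assoc]
    congr 1
    refine Finset.sum_congr rfl fun j hj => ?_
    rw [Function.update_of_ne (Finset.ne_of_mem_erase hj)]
  rw [hsum] at h
  rw [matrixElement, ← h]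
  congr 1
  funext j
  rcases eq_or_ne j 0 with rfl | hj
  · rw [Function.update_self, Function.update_self, higgsMulti_add (D.C_comm x),
      higgsMulti_single, higgsSet_eq_higgsMulti]
    rfl
  · rw [Function.update_of_ne hj, Function.update_of_ne hj, higgsSet_eq_higgsMulti]

/-- The matrix elements of sums of bases have vanishing derivatives. -/
theorem partialDeriv_matrixElement_tupleIndex {I : Fin m → Finset (Fin n)}
    (hI : ∀ j, D.matroid.IsBase (I j : Set (Fin n))) (i : Fin n) (x : M) :
    partialDeriv i (Function.extend Subtype.val (D.matrixElement (tupleIndex I)) 0) x = 0 := by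
  rw [partialDeriv_extend (D.contMDiff_matrixElement _),
    funext (D.matrixElement_tupleIndex I)]
  refine (D.S_flat ⊤ (fun a y => higgsSet D.C (I a) y (D.ζ y))
    (fun a => D.isHolSectionOn_higgsWord _) i x trivial).trans ?_
  refine Finset.sum_eq_zero fun a _ => ?_
  rw [D.covCoord_higgsSet (hI a)]
  exact (D.S x).map_update_zero _ a

/-- In the Leibniz rule for the flat form `S`, only slot 0 with its extra field survives: the other
slots hold flat sections. -/
theorem partialDeriv_matrixElement_add_single {I : Fin m → Finset (Fin n)}
    (hI : ∀ j, D.matroid.IsBase (I j : Set (Fin n))) (i j : Fin n) (x : M) :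
    partialDeriv i (Function.extend Subtype.val
        (D.matrixElement (tupleIndex I + Finsupp.single j 1)) 0) x =
      D.S x (Function.update (fun a => higgsSet D.C (I a) x (D.ζ x)) 0
        (covCoord D.conn i
          (fun y => D.C y (coordField j y) (higgsSet D.C (I 0) y (D.ζ y))) x)) := by
  rw [partialDeriv_extend (D.contMDiff_matrixElement _)]
  let σ : Fin m → Π x : M, K x := Function.update (fun a y => higgsSet D.C (I a) y (D.ζ y)) 0
    (fun y => D.C y (coordField j y) (higgsSet D.C (I 0) y (D.ζ y)))
  have hσ : ∀ a, IsHolSectionOn F (σ a) ((⊤ : Opens M) : Set M) := by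
    intro a
    rcases eq_or_ne a 0 with rfl | ha
    · simp only [σ, Function.update_self]
      exact D.C_hol ⊤ _ (D.isHolSectionOn_higgsWord _) j
    · simp only [σ, Function.update_of_ne ha]
      exact D.isHolSectionOn_higgsWord _
  have hσx : ∀ y, (fun a => σ a y) = Function.update (fun a => higgsSet D.C (I a) y (D.ζ y)) 0
      (D.C y (coordField j y) (higgsSet D.C (I 0) y (D.ζ y))) := by
    intro y
    funext a
    rcases eq_or_ne a 0 with rfl | ha
    · simp [σ]
    · simp [σ, ha]
  have hfun : D.matrixElement (tupleIndex I + Finsupp.single j 1) =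
      fun y => D.S y fun a => σ a y :=
    funext fun y => by rw [D.matrixElement_tupleIndex_add_single I j, hσx]
  rw [hfun]
  refine (D.S_flat ⊤ σ hσ i x trivial).trans ?_
  rw [Finset.sum_eq_single 0]
  · rw [hσx, Function.update_idem]
    simp only [σ, Function.update_self]
    rfl
  · intro a _ ha
    have : covCoord D.conn i (σ a) x = 0 := by
      simp only [σ, Function.update_of_ne ha]
      exact D.covCoord_higgsSet (hI a) i x
    rw [this]
    exact (D.S x).map_update_zero _ a
  · simp

/-- The integrability condition for matrix elements. -/
theorem partialDeriv_matrixElement_comm {I : Fin m → Finset (Fin n)}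
    (hI : ∀ j, D.matroid.IsBase (I j : Set (Fin n))) (i j : Fin n) (x : M) :
    partialDeriv i (Function.extend Subtype.val
        (D.matrixElement (tupleIndex I + Finsupp.single j 1)) 0) x =
      partialDeriv j (Function.extend Subtype.val
        (D.matrixElement (tupleIndex I + Finsupp.single i 1)) 0) x := by
  rw [D.partialDeriv_matrixElement_add_single hI, D.partialDeriv_matrixElement_add_single hI]
  -- The correction terms contain the covariant derivative of the flat section `C_{I 0} ζ` and
  -- vanish.
  have h := D.integrable ⊤ (fun y => higgsSet D.C (I 0) y (D.ζ y))
    (D.isHolSectionOn_higgsWord _) i j x trivial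
  rw [D.covCoord_higgsSet (hI 0), D.covCoord_higgsSet (hI 0), map_zero, map_zero, sub_zero,
    sub_zero] at h
  rw [h]

end FrobeniusLikeStructure

/-! ### Common antiderivatives -/

section Antiderivative

variable {n m : ℕ}

theorem partialWord_append (v w : List (Fin n)) (f : (Fin n → ℂ) → ℂ) :
    partialWord (v ++ w) f = partialWord v (partialWord w f) :=
  List.foldr_append

/-- Flattens the nested derivatives into one word, to which `HasMultiSeries.partialWord` applies;
there only the index of the word matters. -/
theorem exists_word_partialSets (I : Fin m → Finset (Fin n)) :
    ∃ w, wordIndex w = tupleIndex I ∧ ∀ f, partialSets I f = partialWord w f := by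
  have h : ∀ l : List (Finset (Fin n)), ∃ w, wordIndex w = (l.map setIndex).sum ∧
      ∀ f, l.foldr partialSet f = partialWord w f := by
    intro l
    induction l with
    | nil => exact ⟨[], by simp, fun f => rfl⟩
    | cons J l ih =>
      obtain ⟨w, hw, hf⟩ := ih
      refine ⟨J.sort (· ≤ ·) ++ w, ?_, fun f => ?_⟩
      · rw [wordIndex_append, hw, wordIndex_sort]; simp
      · rw [partialWord_append, ← hf]; rfl
  obtain ⟨w, hw, hf⟩ := h (List.ofFn I)
  refine ⟨w, ?_, hf⟩
  rw [hw, List.map_ofFn, List.sum_ofFn]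
  rfl

theorem norm_multiFactorial_div_le_one (S T : Fin n →₀ ℕ) :
    ‖(multiFactorial (S + T) : ℂ)⁻¹ * multiFactorial S‖ ≤ 1 := by
  have h1 : multiFactorial S ≤ multiFactorial (S + T) :=
    Finset.prod_le_prod' fun i _ => Nat.factorial_le (by simp)
  rw [norm_mul, norm_inv, Complex.norm_natCast, Complex.norm_natCast]
  rw [inv_mul_eq_div]
  exact div_le_one_of_le₀ (by exact_mod_cast h1) (Nat.cast_nonneg _)

/-- If the Taylor coefficients of the functions `f T` satisfy the obvious compatibility
conditions, then the `f T` are the derivatives `∂_T L` of one function `L`. -/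
theorem exists_common_antiderivative (A : Finset (Fin n →₀ ℕ))
    {f : (Fin n →₀ ℕ) → (Fin n → ℂ) → ℂ} {c : (Fin n →₀ ℕ) → (Fin n →₀ ℕ) → ℂ}
    {x : Fin n → ℂ} {r : ℝ} (hf : ∀ T ∈ A, HasMultiSeries (f T) x (c T) r)
    (hc : ∀ S T S' T', T ∈ A → T' ∈ A → S + T = S' + T' →
      multiFactorial S * c T S = multiFactorial S' * c T' S') :
    ∃ (L : (Fin n → ℂ) → ℂ) (a : (Fin n →₀ ℕ) → ℂ), HasMultiSeries L x a r ∧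
      (∀ S T, T ∈ A → a (S + T) = (multiFactorial (S + T) : ℂ)⁻¹ * (multiFactorial S * c T S)) ∧
      (∀ T, (¬ ∃ S T', T' ∈ A ∧ T = S + T') → a T = 0) ∧
      ∀ w, wordIndex w ∈ A → Set.EqOn (partialWord w L) (f (wordIndex w)) (Metric.ball x r) := by
  classical
  -- `multiFactorial S * c T S` is ∂_S f_T at `x`; by `hc` the chosen decomposition does not matter.
  let a : (Fin n →₀ ℕ) → ℂ := fun T =>
    if h : ∃ S T', T' ∈ A ∧ T = S + T' then
      (multiFactorial T : ℂ)⁻¹ * (multiFactorial h.choose * c h.choose_spec.choose h.choose)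
    else 0
  have ha : ∀ S T, T ∈ A →
      a (S + T) = (multiFactorial (S + T) : ℂ)⁻¹ * (multiFactorial S * c T S) := by
    intro S T hT
    have h : ∃ S' T', T' ∈ A ∧ S + T = S' + T' := ⟨S, T, hT, rfl⟩
    simp only [a, dif_pos h]
    rw [hc _ _ _ _ h.choose_spec.choose_spec.1 hT h.choose_spec.choose_spec.2.symm]
  have ha0 : ∀ T, (¬ ∃ S T', T' ∈ A ∧ T = S + T') → a T = 0 := fun T h => by
    simp only [a, dif_neg h]
  have hL : HasMultiSeries (fun z => ∑' T, a T * multiPow z x T) x a r := by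
    intro z hz
    refine Summable.hasSum ?_
    -- Majorant: for each of the finitely many `T' ∈ A`, the series of `f T'` shifted by `T'`. The
    -- factorial quotients in `a` have norm at most 1.
    let b : (Fin n →₀ ℕ) → (Fin n →₀ ℕ) → ℝ := fun T' T =>
      if T' ≤ T then ‖c T' (T - T') * multiPow z x (T - T')‖ * ‖multiPow z x T'‖ else 0
    have hb0 : ∀ T' T, 0 ≤ b T' T := by
      intro T' T
      simp only [b]
      split_ifs <;> positivity
    have hb : ∀ T' ∈ A, Summable (b T') := by
      intro T' hT'
      rw [← (add_left_injective T').summable_iff]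
      · refine ((hf T' hT' z hz).summable.norm.mul_right ‖multiPow z x T'‖).congr fun T => ?_
        simp [b]
      · intro T hT
        refine if_neg fun hle => hT ⟨T - T', tsub_add_cancel_of_le hle⟩
    refine Summable.of_norm_bounded (summable_sum hb) fun T => ?_
    by_cases h : ∃ S T', T' ∈ A ∧ T = S + T'
    · obtain ⟨S, T', hT', rfl⟩ := h
      refine le_trans ?_ (Finset.single_le_sum (fun T' _ => hb0 T' _) hT')
      have h1 : b T' (S + T') = ‖c T' S * multiPow z x S‖ * ‖multiPow z x T'‖ := by simp [b]
      have h2 : a (S + T') * multiPow z x (S + T') =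
          (multiFactorial (S + T') : ℂ)⁻¹ * multiFactorial S *
            (c T' S * multiPow z x S * multiPow z x T') := by
        rw [ha S T' hT', multiPow_add]
        ring
      rw [h1, h2, norm_mul, norm_mul (c T' S * _)]
      exact mul_le_of_le_one_left (by positivity) (norm_multiFactorial_div_le_one S T')
    · rw [ha0 T h]
      simpa using Finset.sum_nonneg fun T' _ => hb0 T' T
  refine ⟨_, a, hL, ha, ha0, fun w hw => ?_⟩
  refine ((hL.partialWord w).congr_coeff fun T => ?_).eqOn (hf _ hw)
  rw [ha T _ hw]
  have h1 := multiFactorial_ne_zero T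
  have h2 := multiFactorial_ne_zero (T + wordIndex w)
  field_simp

/-- A polynomial as a power series at the origin. -/
theorem hasMultiSeries_eval (P : MvPolynomial (Fin n) ℂ) (r : ℝ) :
    HasMultiSeries (fun z => MvPolynomial.eval z P) 0 (fun T => P.coeff T) r := by
  intro z _
  have h : MvPolynomial.eval z P = ∑ T ∈ P.support, P.coeff T * multiPow z 0 T := by
    rw [MvPolynomial.eval_eq']
    simp [multiPow]
  beta_reduce
  rw [h]
  refine hasSum_sum_of_ne_finset_zero fun T hT => ?_
  rw [MvPolynomial.notMem_support_iff.1 hT, zero_mul]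

end Antiderivative

/-! ### Strong systems -/

section StrongSystem

variable {n m : ℕ} {N : Matroid (Fin n)} {T : Fin n →₀ ℕ}

theorem isStrongSystem_zero_iff : IsStrongSystem N m 0 T ↔
    ∃ I : Fin m → Finset (Fin n), (∀ j, N.IsBase (I j : Set (Fin n))) ∧ T = tupleIndex I := by
  constructor
  · rintro ⟨I, R, hI, hR, rfl⟩
    rw [Finsupp.degree_eq_zero_iff] at hR
    exact ⟨I, hI, by rw [hR, add_zero]; rfl⟩
  · rintro ⟨I, hI, rfl⟩
    exact ⟨I, 0, hI, by simp, by rw [add_zero]; rfl⟩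

theorem isStrongSystem_one_iff : IsStrongSystem N m 1 T ↔
    ∃ (I : Fin m → Finset (Fin n)) (i : Fin n), (∀ j, N.IsBase (I j : Set (Fin n))) ∧
      T = tupleIndex I + Finsupp.single i 1 := by
  constructor
  · rintro ⟨I, R, hI, hR, rfl⟩
    obtain ⟨i, hi⟩ : ∃ i, R i ≠ 0 := by
      by_contra! hcon
      simp [show R = 0 from Finsupp.ext hcon] at hR
    obtain ⟨R', rfl⟩ := exists_add_of_le
      (Finsupp.single_le_iff.2 (Nat.one_le_iff_ne_zero.2 hi) : Finsupp.single i 1 ≤ R)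
    have hR' : R'.degree = 0 := by simpa using hR
    rw [Finsupp.degree_eq_zero_iff] at hR'
    exact ⟨I, i, hI, by rw [hR', add_zero]; rfl⟩
  · rintro ⟨I, i, hI, rfl⟩
    exact ⟨I, _, hI, by simp, rfl⟩

theorem finite_setOf_isStrongSystem_one : {T | IsStrongSystem N m 1 T}.Finite := by
  refine (Set.finite_range fun p : (Fin m → Finset (Fin n)) × Fin n =>
    tupleIndex p.1 + Finsupp.single p.2 1).subset ?_
  intro T hT
  obtain ⟨I, i, -, rfl⟩ := isStrongSystem_one_iff.1 hT
  exact ⟨(I, i), rfl⟩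

theorem sum_tupleIndex_of_isBase {k : ℕ} (hk : N.eRank = k) {I : Fin m → Finset (Fin n)}
    (hI : ∀ j, N.IsBase (I j : Set (Fin n))) : ∑ i, tupleIndex I i = m * k := by
  rw [sum_tupleIndex]
  have : ∀ j, (I j ∩ Finset.univ).card = k := by
    intro j
    have h := (hI j).encard_eq_eRank
    rw [hk, Set.encard_coe_eq_coe_finsetCard] at h
    rw [Finset.inter_univ]
    exact_mod_cast h
  simp only [this, Finset.sum_const, Finset.card_univ, Fintype.card_fin, smul_eq_mul]

end StrongSystem

/-! ### Potentials -/

namespace FrobeniusLikeStructure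

variable {n k m : ℕ} {M : Opens (Fin n → ℂ)}
  {F : Type*} [NormedAddCommGroup F] [NormedSpace ℂ F]
  {K : M → Type*} [TopologicalSpace (TotalSpace F K)]
  [∀ x, AddCommGroup (K x)] [∀ x, Module ℂ (K x)] [∀ x, TopologicalSpace (K x)]
  [∀ x, IsTopologicalAddGroup (K x)] [∀ x, ContinuousSMul ℂ (K x)]
  [FiberBundle F K] [VectorBundle ℂ F K]
  (D : FrobeniusLikeStructure k m M F K) [NeZero m]

/-- All partial derivatives vanish and the ball is connected. -/
theorem matrixElement_tupleIndex_eq {I : Fin m → Finset (Fin n)}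
    (hI : ∀ j, D.matroid.IsBase (I j : Set (Fin n))) {x z : M} {r : ℝ}
    (hr : Metric.ball (x : Fin n → ℂ) r ⊆ M)
    (hz : (z : Fin n → ℂ) ∈ Metric.ball (x : Fin n → ℂ) r) :
    D.matrixElement (tupleIndex I) z = D.matrixElement (tupleIndex I) x := by
  let f := Function.extend Subtype.val (D.matrixElement (tupleIndex I)) 0
  have hf : ∀ y : M, f y = D.matrixElement (tupleIndex I) y :=
    fun y => Subtype.val_injective.extend_apply _ _ _
  have han : ∀ y : M, AnalyticAt ℂ f y := analyticAt_extend (D.contMDiff_matrixElement _)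
  have hder : ∀ y : M, fderiv ℂ f y = 0 := by
    intro y
    refine ContinuousLinearMap.coe_injective (LinearMap.pi_ext' fun i => LinearMap.ext_ring ?_)
    exact D.partialDeriv_matrixElement_tupleIndex hI i y
  rw [← hf, ← hf]
  refine Metric.isOpen_ball.is_const_of_fderiv_eq_zero (𝕜 := ℂ)
    (convex_ball (x : Fin n → ℂ) r).isPreconnected
    (fun y hy => (han ⟨y, hr hy⟩).differentiableAt.differentiableWithinAt)
    (fun y hy => hder ⟨y, hr hy⟩) hz ?_
  exact Metric.mem_ball_self (dist_nonneg.trans_lt hz)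

/-- The degree condition in the index set is automatic, as a sum of `m` bases has degree `m * k`. -/
theorem coeff_firstKindPolynomial (x : M) (T : Fin n →₀ ℕ)
    [Decidable (IsStrongSystem D.matroid m 0 T)] :
    (D.firstKindPolynomial x).coeff T = if IsStrongSystem D.matroid m 0 T then
      (multiFactorial T : ℂ)⁻¹ * D.matrixElement T x else 0 := by
  classical
  rw [firstKindPolynomial, MvPolynomial.coeff_sum]
  simp only [MvPolynomial.coeff_monomial, Finset.sum_ite_eq', Finset.mem_filter]
  by_cases h : IsStrongSystem D.matroid m 0 T
  · have : T ∈ Finset.univ.finsuppAntidiag (m * k) := by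
      obtain ⟨I, hI, rfl⟩ := isStrongSystem_zero_iff.1 h
      simpa using sum_tupleIndex_of_isBase D.matroid_rank hI
    simp [h, this]
  · simp [h]

theorem isPotentialFirstKind_firstKindPolynomial {x : M} {U : Opens (Fin n → ℂ)} {r : ℝ}
    (hU : (U : Set (Fin n → ℂ)) = Metric.ball (x : Fin n → ℂ) r) (hUM : U ≤ M) :
    D.IsPotentialFirstKind U fun z => MvPolynomial.eval z (D.firstKindPolynomial x) := by
  classical
  have hs := hasMultiSeries_eval (D.firstKindPolynomial x)
  -- A polynomial is its own series at the origin on every polydisc; this radius makes the polydisc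
  -- contain `z`.
  refine ⟨fun z _ => (hs (dist z 0 + 1)).analyticAt (by simp), fun I hI z hz => ?_⟩
  obtain ⟨w, hw, hpart⟩ := exists_word_partialSets I
  have hz' : (z : Fin n → ℂ) ∈ Metric.ball (x : Fin n → ℂ) r := hU ▸ hz
  rw [← D.matrixElement_tupleIndex, D.matrixElement_tupleIndex_eq hI (hU ▸ hUM) hz', hpart]
  have h := ((hs (dist (z : Fin n → ℂ) 0 + 1)).partialWord w) z (by simp)
  refine h.unique ?_
  convert hasSum_single (0 : Fin n →₀ ℕ) ?_ using 1
  · have hstrong : IsStrongSystem D.matroid m 0 (tupleIndex I) :=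
      isStrongSystem_zero_iff.2 ⟨I, hI, rfl⟩
    have h1 := multiFactorial_ne_zero (tupleIndex I)
    beta_reduce
    rw [zero_add, hw, coeff_firstKindPolynomial, if_pos hstrong]
    simp [multiPow]
    field_simp
  · intro T hT
    -- For `T ≠ 0` the degree exceeds `m * k`, so only the constant term of the derivative survives.
    have hnot : ¬ IsStrongSystem D.matroid m 0 (T + wordIndex w) := by
      rw [hw]
      intro h
      obtain ⟨J, hJ, hTJ⟩ := isStrongSystem_zero_iff.1 h
      have h1 := sum_tupleIndex_of_isBase D.matroid_rank hJ
      have h2 := sum_tupleIndex_of_isBase D.matroid_rank hI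
      rw [← hTJ] at h1
      simp only [Finsupp.add_apply, Finset.sum_add_distrib] at h1
      refine hT ((Finsupp.degree_eq_zero_iff T).1 ?_)
      rw [finsupp_degree_eq_sum]
      omega
    beta_reduce
    rw [coeff_firstKindPolynomial, if_neg hnot]
    simp

/-- The number `∂_{T₁} S(C_{T₂} ζ, ζ, …, ζ)(x)`, where `T₂` is a strong system, only depends on
`T₁ + T₂`. -/
theorem multiFactorial_mul_coeff_eq {x : M} {r : ℝ} (hr0 : 0 < r)
    (hr : Metric.ball (x : Fin n → ℂ) r ⊆ M) {c : (Fin n →₀ ℕ) → (Fin n →₀ ℕ) → ℂ}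
    (hc : ∀ T, IsStrongSystem D.matroid m 1 T →
      HasMultiSeries (Function.extend Subtype.val (D.matrixElement T) 0) x (c T) r)
    {S T S' T' : Fin n →₀ ℕ} (hT : IsStrongSystem D.matroid m 1 T)
    (hT' : IsStrongSystem D.matroid m 1 T') (hST : S + T = S' + T') :
    multiFactorial S * c T S = multiFactorial S' * c T' S' := by
  classical
  -- Comparison of Taylor coefficients in ∂_i g_{B+e_j} = ∂_j g_{B+e_i}.
  have hsymm : ∀ I : Fin m → Finset (Fin n), (∀ j, D.matroid.IsBase (I j : Set (Fin n))) →
      ∀ i j R, multiFactorial (R + Finsupp.single i 1) *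
          c (tupleIndex I + Finsupp.single j 1) (R + Finsupp.single i 1) =
        multiFactorial (R + Finsupp.single j 1) *
          c (tupleIndex I + Finsupp.single i 1) (R + Finsupp.single j 1) := by
    intro I hI i j R
    have hi := (hc _ (isStrongSystem_one_iff.2 ⟨I, j, hI, rfl⟩)).partialDeriv i
    have hj := (hc _ (isStrongSystem_one_iff.2 ⟨I, i, hI, rfl⟩)).partialDeriv j
    have h := congrFun (hi.coeff_unique (hj.congr fun z hz =>
      D.partialDeriv_matrixElement_comm hI j i ⟨z, hr hz⟩) hr0) R
    rw [multiFactorial_add_single, multiFactorial_add_single]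
    push_cast
    linear_combination (multiFactorial R : ℂ) * h
  have hmove : ∀ I : Fin m → Finset (Fin n), (∀ j, D.matroid.IsBase (I j : Set (Fin n))) →
      ∀ i j R R', Finsupp.single j 1 + R = Finsupp.single i 1 + R' →
        multiFactorial R * c (tupleIndex I + Finsupp.single j 1) R =
          multiFactorial R' * c (tupleIndex I + Finsupp.single i 1) R' := by
    intro I hI i j R R' h
    rcases eq_or_ne i j with rfl | hij
    · rw [add_left_cancel h]
    · have hle : Finsupp.single i 1 ≤ R := by
        rw [Finsupp.single_le_iff]
        have := DFunLike.congr_fun h i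
        simp [hij.symm] at this
        omega
      obtain ⟨R₀, rfl⟩ := exists_add_of_le hle
      have hR' : R' = Finsupp.single j 1 + R₀ := by
        rw [add_left_comm] at h
        exact (add_left_cancel h).symm
      rw [hR', add_comm _ R₀, add_comm _ R₀]
      exact hsymm I hI i j R₀
  obtain ⟨I, i, hI, rfl⟩ := isStrongSystem_one_iff.1 hT
  obtain ⟨I', i', hI', rfl⟩ := isStrongSystem_one_iff.1 hT'
  -- Quantifying over every extra letter `j` makes the property depend on the sum of bases alone, as
  -- the exchange argument requires.
  let P : (Fin n →₀ ℕ) → Prop := fun B => ∀ j R, B + Finsupp.single j 1 + R =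
    S + (tupleIndex I + Finsupp.single i 1) →
      multiFactorial R * c (B + Finsupp.single j 1) R =
        multiFactorial S * c (tupleIndex I + Finsupp.single i 1) S
  -- The multi-index B + e_v = B' + e_u is an (mk+1)-system arising from both sums of bases: use the
  -- property of B with letter `v`, then pass from `u` to `j` over B' by `hmove`.
  have hP : ExchangeStable D.matroid m (S + (tupleIndex I + Finsupp.single i 1)) P := by
    intro J J' hJ hJ' u v huv hle hPJ j R hR
    obtain ⟨R₀, hR₀⟩ := exists_add_of_le hle
    rw [← hPJ v R₀ hR₀.symm, ← huv]
    refine hmove J' hJ' u j R R₀ (add_left_cancel (a := tupleIndex J') ?_)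
    rw [← add_assoc, ← add_assoc, huv, ← hR₀, hR]
  have hPI : P (tupleIndex I) := by
    intro j R hR
    refine hmove I hI i j R S (add_left_cancel (a := tupleIndex I) ?_)
    rw [← add_assoc, hR]
    abel
  refine (hP.of_base_tuple D.matroid_ground hI hI' ?_ ?_ hPI i' S' ?_).symm
  · rw [add_left_comm]; exact le_self_add
  · rw [hST, add_left_comm]; exact le_self_add
  · rw [hST, add_comm]

end FrobeniusLikeStructure

end

/-! ### Both potentials on a common polydisc -/

theorem theorem1p2 {n k m : ℕ} [NeZero n] [NeZero k] [NeZero m] (M : Opens (Fin n → ℂ))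
    (F : Type*) [NormedAddCommGroup F] [NormedSpace ℂ F] [FiniteDimensional ℂ F]
    (K : M → Type*) [TopologicalSpace (TotalSpace F K)]
    [∀ x, AddCommGroup (K x)] [∀ x, Module ℂ (K x)] [∀ x, TopologicalSpace (K x)]
    [∀ x, IsTopologicalAddGroup (K x)] [∀ x, ContinuousSMul ℂ (K x)]
    [FiberBundle F K] [VectorBundle ℂ F K]
    [ContMDiffVectorBundle ω F K 𝓘(ℂ, Fin n → ℂ)]
    (D : FrobeniusLikeStructure k m M F K) (x : M) :
    ∃ U : Opens (Fin n → ℂ), (x : Fin n → ℂ) ∈ U ∧ U ≤ M ∧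
      (∃ Q : (Fin n → ℂ) → ℂ, D.IsPotentialFirstKind U Q ∧
        ∀ z ∈ U, Q z = MvPolynomial.eval z (D.firstKindPolynomial x)) ∧
      (∃ (L : (Fin n → ℂ) → ℂ) (a : (Fin n →₀ ℕ) → ℂ), D.IsPotentialSecondKind U L ∧
        (∀ z ∈ U, HasSum (fun T => a T * multiPow z x T) (L z)) ∧
        (∀ T₁ T₂, IsStrongSystem D.matroid m 1 T₂ → a (T₁ + T₂) = D.secondKindCoeff x T₁ T₂) ∧
        (∀ T, (¬ ∃ T₁ T₂, IsStrongSystem D.matroid m 1 T₂ ∧ T = T₁ + T₂) → a T = 0)) := by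
  classical
  choose ρ hρ0 c hc using fun T =>
    (analyticAt_extend (D.contMDiff_matrixElement T) x).exists_hasMultiSeries
  let A : Finset (Fin n →₀ ℕ) :=
    (finite_setOf_isStrongSystem_one (N := D.matroid) (m := m)).toFinset
  have hA : ∀ T, T ∈ A ↔ IsStrongSystem D.matroid m 1 T := fun T => by simp [A]
  obtain ⟨ε, hε0, hε⟩ := Metric.isOpen_iff.1 M.isOpen x x.2
  -- A common radius exists because there are only finitely many strong (mk+1)-systems.
  obtain ⟨r, hr0, hrε, hrA⟩ : ∃ r > 0, r ≤ ε ∧ ∀ T ∈ A, r ≤ ρ T := by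
    have h : ∀ᶠ r in nhdsWithin (0 : ℝ) (Set.Ioi 0), 0 < r ∧ r ≤ ε ∧ ∀ T ∈ A, r ≤ ρ T := by
      have hle : ∀ δ : ℝ, 0 < δ → ∀ᶠ r in nhdsWithin (0 : ℝ) (Set.Ioi 0), r ≤ δ := fun δ hδ =>
        Filter.mem_of_superset (Ioc_mem_nhdsGT hδ) fun _ h => h.2
      refine Filter.Eventually.and self_mem_nhdsWithin ((hle ε hε0).and ?_)
      exact (Filter.eventually_all_finset A).2 fun T _ => hle _ (hρ0 T)
    obtain ⟨r, h1, h2, h3⟩ := h.exists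
    exact ⟨r, h1, h2, h3⟩
  have hrM : Metric.ball (x : Fin n → ℂ) r ⊆ M := (Metric.ball_subset_ball hrε).trans hε
  have hcA : ∀ T ∈ A,
      HasMultiSeries (Function.extend Subtype.val (D.matrixElement T) 0) x (c T) r :=
    fun T hT => (hc T).mono (hrA T hT)
  obtain ⟨L, a, hL, ha, ha0, hLA⟩ := exists_common_antiderivative A hcA fun S T S' T' hT hT' h =>
    D.multiFactorial_mul_coeff_eq hr0 hrM (fun T hT => hcA T ((hA T).2 hT)) ((hA T).1 hT)
      ((hA T').1 hT') h
  refine ⟨⟨Metric.ball (x : Fin n → ℂ) r, Metric.isOpen_ball⟩, Metric.mem_ball_self hr0, hrM,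
    ⟨_, D.isPotentialFirstKind_firstKindPolynomial rfl hrM, fun _ _ => rfl⟩,
    L, a, ⟨hL.analyticOnNhd, fun I hI i z hz => ?_⟩, hL, fun T₁ T₂ hT₂ => ?_, fun T hT => ?_⟩
  · obtain ⟨w, hw, hpart⟩ := exists_word_partialSets I
    have hiw : wordIndex (i :: w) = tupleIndex I + Finsupp.single i 1 := by
      rw [wordIndex_cons, hw, add_comm]
    have hmem : wordIndex (i :: w) ∈ A :=
      (hA _).2 (isStrongSystem_one_iff.2 ⟨I, i, hI, hiw⟩)
    rw [hpart, ← D.matrixElement_tupleIndex_add_single, ← hiw]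
    exact (hLA _ hmem hz).trans (Subtype.val_injective.extend_apply _ _ _)
  · rw [ha T₁ T₂ ((hA T₂).2 hT₂), FrobeniusLikeStructure.secondKindCoeff,
      (hcA T₂ ((hA T₂).2 hT₂)).partialMulti_apply_center hr0]
  · refine ha0 T fun ⟨S, T', hT', h⟩ => hT ⟨S, T', (hA T').1 hT', h⟩
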